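/- Let $\mathfrak a_1,\dots,\mathfrak a_d$ be a basis of $\mathbb R^d$ and let $\mathfrak b_1,\dots,\mathfrak b_d$ be the dual basis, $\mathfrak a_i\cdot\mathfrak b_j=2\pi\delta_{ij}$. For $k\in\mathbb Z^d$ and $\theta\in\mathbb R^d$ write $k_{\mathfrak a}=\sum_i k_i\mathfrak a_i$ and $\theta_{\mathfrak b}=\sum_i\theta_i\mathfrak b_i$. Let $\Gamma=(V,E)$ be a locally finite graph with vertex set $V\subset\mathbb R^d$, invariant (vertices and edges) under the translations by $\mathfrak a_1,\dots,\mathfrak a_d$, such that the unit crystal $V_f=V\cap\{\sum_i x_i\mathfrak a_i: x_i\in[0,1)\}$ is finite, with $\nu$ elements. Every $u\in V$ has a fractional part $\{u\}_{\mathfrak a}\in V_f$, with $u-\{u\}_{\mathfrak a}\in\{k_{\mathfrak a}:k\in\mathbb Z^d\}$. Let $Q:V\to\mathbb R$ satisfy $Q(v+\mathfrak a_i)=Q(v)$, and let $H=\mathcal A+Q$ be the bounded operator $(H\psi)(v)=\sum_{u\sim v}\psi(u)+Q(v)\psi(v)$ on $\ell^2(V)$. Let $\psi\in\ell^2(V)$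 with $\|\psi\|=1$. For $v\in V_f$ let $(U\psi)_{\theta_{\mathfrak b}}(v)=\sum_{k\in\mathbb Z^d}e^{-\mathrm i\theta_{\mathfrak b}\cdot(v+k_{\mathfrak a})}\psi(v+k_{\mathfrak a})$, the series converging in $L^2([0,1)^d,d\theta)$. Let $H(\theta_{\mathfrak b})$ be the Hermitian operator on $\mathbb C^{V_f}$ given by $[H(\theta_{\mathfrak b})f](v)=\sum_{u\sim v}e^{\mathrm i\theta_{\mathfrak b}\cdot(u-v)}f(\{u\}_{\mathfrak a})+Q(v)f(v)$, the sum being over the neighbours $u$ of $v$ in $\Gamma$. Let $E_1(\theta_{\mathfrak b})\le\dots\le E_\nu(\theta_{\mathfrak b})$ be its eigenvalues, counted with multiplicity, and let $P_1(\theta_{\mathfrak b}),\dots,P_\nu(\theta_{\mathfrak b})$ be corresponding eigenprojections, chosen measurably in $\theta$: mutually orthogonal orthogonal projections with $\sum_nP_n(\theta_{\mathfrak b})=\mathrm{Id}$ and $H(\theta_{\mathfrak b})=\sum_nE_n(\theta_{\mathfrak b})P_n(\theta_{\mathfrak b})$. Such a choice exists. For any such choice, the measure $\mu^\psi$ on $[0,1)^d\times\{1,\dots,\nu\}$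 defined by $$\int f\,d\mu^\psi=\int_{[0,1)^d}\sum_{n=1}^{\nu}f(\theta,n)\,\|P_n(\theta_{\mathfrak b})(U\psi)_{\theta_{\mathfrak b}}\|^2\,d\theta$$ and its image $\nu_\infty^\psi=h_*\mu^\psi$ on $\mathbb R^d$ under $$h(\theta,n)=\frac1{2\pi}\sum_{i=1}^d\mathfrak a_i\,\partial_{\theta_i}\big[E_n(\theta_{\mathfrak b})\big]$$ (defined for almost every $\theta$) are probability measures. For each $t\in\mathbb R$ the function $v\mapsto|e^{-\mathrm itH}\psi(v)|^2$ is a probability distribution on $V$; if $X_t$ is a random vector with this distribution, then, as $t\to+\infty$, $X_t/t$ converges in distribution to a random vector $Y$ with distribution $\nu_\infty^\psi$. -/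

import Mathlib

open MeasureTheory ProbabilityTheory Filter
open scoped Matrix ENNReal

noncomputable section

/-- A locally finite graph drawn in `ℝ^d` (the vertices are points of `ℝ^d`), invariant under the
translations by the vectors of a basis `a` of `ℝ^d`, with finitely many vertices in the unit cell
`{∑ xᵢ aᵢ : xᵢ ∈ [0,1)}`. -/
structure PeriodicGraph (d : ℕ) where
  /-- the period vectors `a₁, …, a_d` -/
  a : Module.Basis (Fin d) ℝ (EuclideanSpace ℝ (Fin d))
  /-- the vertex set -/
  V : Set (EuclideanSpace ℝ (Fin d))
  /-- the edges -/
  graph : SimpleGraph V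
  locallyFinite : ∀ v : V, (graph.neighborSet v).Finite
  add_mem_iff : ∀ (i : Fin d) (x : EuclideanSpace ℝ (Fin d)), x + a i ∈ V ↔ x ∈ V
  adj_add_iff : ∀ (i : Fin d) (u v u' v' : V),
    (u' : EuclideanSpace ℝ (Fin d)) = u + a i → (v' : EuclideanSpace ℝ (Fin d)) = v + a i →
      (graph.Adj u' v' ↔ graph.Adj u v)
  finite_cell : (V ∩ ZSpan.fundamentalDomain a).Finite

namespace PeriodicGraph

variable {d : ℕ} (Γ : PeriodicGraph d)

/-- The lattice of periods `ℤ_a^d`. -/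
abbrev lattice : Submodule ℤ (EuclideanSpace ℝ (Fin d)) := Submodule.span ℤ (Set.range Γ.a)

/-- The lattice vector `k_a = ∑ kᵢ aᵢ`. -/
def latticeVec (k : Fin d → ℤ) : EuclideanSpace ℝ (Fin d) := ∑ i, k i • Γ.a i

lemma latticeVec_mem (k : Fin d → ℤ) : Γ.latticeVec k ∈ Γ.lattice :=
  Submodule.sum_mem _ fun i _ => Submodule.smul_mem _ _ (Submodule.subset_span ⟨i, rfl⟩)

lemma lattice_induction {p : EuclideanSpace ℝ (Fin d) → Prop} (h0 : p 0) (ha : ∀ i, p (Γ.a i))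
    (hadd : ∀ x y, p x → p y → p (x + y)) (hneg : ∀ x, p x → p (-x))
    {l : EuclideanSpace ℝ (Fin d)} (hl : l ∈ Γ.lattice) : p l := by
  have hl' : l ∈ AddSubgroup.closure (Set.range Γ.a) := by
    rw [← Submodule.span_int_eq_addSubgroupClosure]; exact hl
  induction hl' using AddSubgroup.closure_induction with
  | mem x hx => obtain ⟨i, rfl⟩ := hx; exact ha i
  | zero => exact h0
  | add x y _ _ hx hy =>
    rename_i h1 h2
    refine hadd x y (hx ?_) (hy ?_)
    · rw [← Submodule.span_int_eq_addSubgroupClosure] at h1; exact h1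
    · rw [← Submodule.span_int_eq_addSubgroupClosure] at h2; exact h2
  | neg x _ hx =>
    rename_i h1
    refine hneg x (hx ?_)
    rw [← Submodule.span_int_eq_addSubgroupClosure] at h1; exact h1

lemma add_lattice_mem_iff {l : EuclideanSpace ℝ (Fin d)} (hl : l ∈ Γ.lattice) :
    ∀ x, x + l ∈ Γ.V ↔ x ∈ Γ.V := by
  refine Γ.lattice_induction (p := fun l => ∀ x, x + l ∈ Γ.V ↔ x ∈ Γ.V) (by simp)
    (fun i x => Γ.add_mem_iff i x) (fun x y hx hy z => ?_) (fun x hx z => ?_) hl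
  · rw [← add_assoc, hy, hx]
  · rw [← hx (z + -x)]; simp

/-- The translate `v + l` of a vertex by a period `l`. -/
def translate (l : Γ.lattice) (v : Γ.V) : Γ.V :=
  ⟨v + l, (Γ.add_lattice_mem_iff l.2 v).2 v.2⟩

@[simp] lemma coe_translate (l : Γ.lattice) (v : Γ.V) :
    (Γ.translate l v : EuclideanSpace ℝ (Fin d)) = v + l := rfl

lemma translate_translate (l m : Γ.lattice) (v : Γ.V) :
    Γ.translate l (Γ.translate m v) = Γ.translate (m + l) v :=
  Subtype.ext (by simp [add_assoc])

lemma translate_zero (v : Γ.V) : Γ.translate 0 v = v := Subtype.ext (by simp)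

lemma adj_lattice {l : EuclideanSpace ℝ (Fin d)} (hl : l ∈ Γ.lattice) :
    ∀ (u v u' v' : Γ.V), (u' : EuclideanSpace ℝ (Fin d)) = u + l →
      (v' : EuclideanSpace ℝ (Fin d)) = v + l → (Γ.graph.Adj u' v' ↔ Γ.graph.Adj u v) := by
  suffices h : l ∈ Γ.lattice ∧ ∀ (u v u' v' : Γ.V), (u' : EuclideanSpace ℝ (Fin d)) = u + l →
      (v' : EuclideanSpace ℝ (Fin d)) = v + l → (Γ.graph.Adj u' v' ↔ Γ.graph.Adj u v) from h.2
  refine Γ.lattice_induction (p := fun l => l ∈ Γ.lattice ∧ ∀ (u v u' v' : Γ.V),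
      (u' : EuclideanSpace ℝ (Fin d)) = u + l →
      (v' : EuclideanSpace ℝ (Fin d)) = v + l → (Γ.graph.Adj u' v' ↔ Γ.graph.Adj u v))
    ⟨zero_mem _, fun u v u' v' hu hv => ?_⟩
    (fun i => ⟨Submodule.subset_span ⟨i, rfl⟩, Γ.adj_add_iff i⟩)
    (fun x y hx hy => ⟨add_mem hx.1 hy.1, fun u v u' v' hu hv => ?_⟩)
    (fun x hx => ⟨neg_mem hx.1, fun u v u' v' hu hv => ?_⟩) hl
  · rw [add_zero] at hu hv
    rw [Subtype.ext hu, Subtype.ext hv]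
  · rw [hy.2 (Γ.translate ⟨x, hx.1⟩ u) (Γ.translate ⟨x, hx.1⟩ v) u' v'
      (by simp [hu, add_assoc]) (by simp [hv, add_assoc])]
    exact hx.2 u v _ _ rfl rfl
  · exact (hx.2 u' v' u v (by simp [hu]) (by simp [hv])).symm

lemma adj_translate_iff (l : Γ.lattice) (u v : Γ.V) :
    Γ.graph.Adj (Γ.translate l u) (Γ.translate l v) ↔ Γ.graph.Adj u v :=
  Γ.adj_lattice l.2 u v _ _ rfl rfl

/-- The unit crystal `V_f`: the vertices in the unit cell. -/
abbrev Cell : Type := {v : Γ.V // (v : EuclideanSpace ℝ (Fin d)) ∈ ZSpan.fundamentalDomain Γ.a}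

instance : Finite Γ.Cell := by
  have := Γ.finite_cell.to_subtype
  exact Finite.of_injective
    (fun v : Γ.Cell => (⟨v.1, v.1.2, v.2⟩ : ↥(Γ.V ∩ ZSpan.fundamentalDomain Γ.a)))
    fun v w h => Subtype.ext (Subtype.ext (congrArg (fun z => z.1) h))

instance : Fintype Γ.Cell := Fintype.ofFinite _

instance : DecidableEq Γ.Cell := Classical.decEq _

/-- The number `ν` of vertices in the unit cell. -/
abbrev cellCard : ℕ := Fintype.card Γ.Cell

/-- The fractional part `{v}_a ∈ V_f` of a vertex. -/
def frac (v : Γ.V) : Γ.Cell :=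
  ⟨Γ.translate (-ZSpan.floor Γ.a v) v, by
    have := ZSpan.fract_mem_fundamentalDomain Γ.a (v : EuclideanSpace ℝ (Fin d))
    simpa [ZSpan.fract_apply, sub_eq_add_neg] using this⟩

lemma coe_frac (v : Γ.V) :
    ((Γ.frac v).1 : EuclideanSpace ℝ (Fin d)) = ZSpan.fract Γ.a (v : EuclideanSpace ℝ (Fin d)) := by
  simp [frac, ZSpan.fract_apply, sub_eq_add_neg]

lemma frac_translate (l : Γ.lattice) (v : Γ.V) : Γ.frac (Γ.translate l v) = Γ.frac v := by
  apply Subtype.ext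
  apply Subtype.ext
  rw [coe_frac, coe_frac, coe_translate]
  exact ZSpan.fract_add_ZSpan Γ.a _ l.2

lemma frac_coe (v : Γ.Cell) : Γ.frac v.1 = v := by
  apply Subtype.ext
  apply Subtype.ext
  rw [coe_frac]
  exact ZSpan.fract_eq_self.2 v.2

/-- The (finite) set of neighbours of a vertex. -/
def nbrs (v : Γ.V) : Finset Γ.V := (Γ.locallyFinite v).toFinset

@[simp] lemma mem_nbrs (v u : Γ.V) : u ∈ Γ.nbrs v ↔ Γ.graph.Adj v u := by simp [nbrs]

lemma card_nbrs_translate (l : Γ.lattice) (v : Γ.V) :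
    (Γ.nbrs (Γ.translate l v)).card = (Γ.nbrs v).card := by
  refine Finset.card_nbij' (Γ.translate (-l)) (Γ.translate l) (fun u hu => ?_) (fun u hu => ?_)
    (fun u _ => ?_) (fun u _ => ?_)
  · simp only [Finset.mem_coe, mem_nbrs] at hu ⊢
    rw [← Γ.adj_translate_iff l, translate_translate]
    simpa [translate_zero] using hu
  · simp only [Finset.mem_coe, mem_nbrs] at hu ⊢
    rwa [Γ.adj_translate_iff l]
  · simp [translate_translate, translate_zero]
  · simp [translate_translate, translate_zero]

lemma exists_card_nbrs_le : ∃ D : ℕ, ∀ v, (Γ.nbrs v).card ≤ D := by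
  refine ⟨Finset.univ.sup fun w : Γ.Cell => (Γ.nbrs w.1).card, fun v => ?_⟩
  rw [← Γ.card_nbrs_translate (-ZSpan.floor Γ.a v) v]
  exact Finset.le_sup (f := fun w : Γ.Cell => (Γ.nbrs w.1).card) (Finset.mem_univ (Γ.frac v))

lemma tsum_nbrs_le {D : ℕ} (hD : ∀ v, (Γ.nbrs v).card ≤ D) (F : Γ.V → ℝ≥0∞) :
    ∑' v, ∑ u ∈ Γ.nbrs v, F u ≤ D * ∑' u, F u := by
  classical
  have h1 : ∀ v, ∑ u ∈ Γ.nbrs v, F u = ∑' u, if Γ.graph.Adj v u then F u else 0 := fun v => by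
    rw [tsum_eq_sum (s := Γ.nbrs v) (fun u hu => by simp at hu; simp [hu])]
    exact Finset.sum_congr rfl fun u hu => by simp at hu; simp [hu]
  have h2 : ∀ u, (∑' v, if Γ.graph.Adj v u then F u else 0) = (Γ.nbrs u).card * F u := fun u => by
    rw [tsum_eq_sum (s := Γ.nbrs u) (fun v hv => by
      rw [mem_nbrs, Γ.graph.adj_comm] at hv; simp [hv])]
    rw [Finset.sum_congr rfl (g := fun _ => F u)
      (fun v hv => by rw [mem_nbrs, Γ.graph.adj_comm] at hv; simp [hv])]
    simp
  simp_rw [h1]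
  rw [ENNReal.tsum_comm]
  simp_rw [h2]
  rw [← ENNReal.tsum_mul_left]
  exact ENNReal.tsum_le_tsum fun u => by gcongr; exact_mod_cast hD u

/-- The Hilbert space `ℓ²(Γ)`. -/
abbrev L2 : Type := lp (fun _ : Γ.V => ℂ) 2

lemma memLp_two_iff (f : Γ.V → ℂ) : Memℓp f 2 ↔ Summable fun v => ‖f v‖ ^ 2 := by
  rw [memℓp_gen_iff (by simp)]
  simp

lemma memLp_adjacency (f : Γ.L2) : Memℓp (fun v => ∑ u ∈ Γ.nbrs v, f u) 2 := by
  obtain ⟨D, hD⟩ := Γ.exists_card_nbrs_le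
  have hf : Summable fun v => ‖f v‖ ^ 2 := (Γ.memLp_two_iff f).1 (lp.memℓp f)
  rw [memLp_two_iff]
  have hs : Summable fun v => ∑ u ∈ Γ.nbrs v, ‖f u‖ ^ 2 := by
    have h := Γ.tsum_nbrs_le hD fun u => ENNReal.ofReal (‖f u‖ ^ 2)
    have hne : (∑' v, ENNReal.ofReal (∑ u ∈ Γ.nbrs v, ‖f u‖ ^ 2)) ≠ ⊤ := by
      simp_rw [ENNReal.ofReal_sum_of_nonneg fun (u : Γ.V) _ => sq_nonneg ‖f u‖]
      exact ne_top_of_le_ne_top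
        (ENNReal.mul_ne_top (ENNReal.natCast_ne_top D) hf.tsum_ofReal_ne_top) h
    have := ENNReal.summable_toReal hne
    simpa [ENNReal.toReal_ofReal (Finset.sum_nonneg fun (u : Γ.V) _ => sq_nonneg ‖f u‖)] using this
  refine Summable.of_nonneg_of_le (fun v => sq_nonneg _) (fun v => ?_) (hs.mul_left (D : ℝ))
  calc ‖∑ u ∈ Γ.nbrs v, f u‖ ^ 2 ≤ (∑ u ∈ Γ.nbrs v, ‖f u‖) ^ 2 := by
        gcongr; exact norm_sum_le _ _
    _ ≤ (Γ.nbrs v).card * ∑ u ∈ Γ.nbrs v, ‖f u‖ ^ 2 := sq_sum_le_card_mul_sum_sq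
    _ ≤ D * ∑ u ∈ Γ.nbrs v, ‖f u‖ ^ 2 := by
        gcongr
        exact_mod_cast hD v

/-- A real potential on the vertices that is invariant under the periods of the graph. -/
structure PeriodicPotential where
  toFun : Γ.V → ℝ
  periodic : ∀ (i : Fin d) (v v' : Γ.V),
    (v' : EuclideanSpace ℝ (Fin d)) = v + Γ.a i → toFun v' = toFun v

namespace PeriodicPotential

variable {Γ} (Q : Γ.PeriodicPotential)

instance : CoeFun Γ.PeriodicPotential fun _ => Γ.V → ℝ := ⟨toFun⟩

lemma apply_translate (l : Γ.lattice) (v : Γ.V) : Q (Γ.translate l v) = Q v := by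
  suffices h : (l : EuclideanSpace ℝ (Fin d)) ∈ Γ.lattice ∧ ∀ v v' : Γ.V,
      (v' : EuclideanSpace ℝ (Fin d)) = v + l → Q v' = Q v from h.2 v _ rfl
  refine Γ.lattice_induction (p := fun l => l ∈ Γ.lattice ∧ ∀ v v' : Γ.V,
      (v' : EuclideanSpace ℝ (Fin d)) = v + l → Q v' = Q v)
    ⟨zero_mem _, fun v v' h => ?_⟩ (fun i => ⟨Submodule.subset_span ⟨i, rfl⟩, Q.periodic i⟩)
    (fun x y hx hy => ⟨add_mem hx.1 hy.1, fun v v' h => ?_⟩)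
    (fun x hx => ⟨neg_mem hx.1, fun v v' h => ?_⟩) l.2
  · rw [add_zero] at h
    rw [Subtype.ext h]
  · rw [hy.2 (Γ.translate ⟨x, hx.1⟩ v) v' (by simp [h, add_assoc])]
    exact hx.2 v _ rfl
  · exact (hx.2 v' v (by simp [h])).symm

lemma exists_abs_le : ∃ C : ℝ, ∀ v, |Q v| ≤ C := by
  obtain ⟨C, hC⟩ := (Set.finite_range fun w : Γ.Cell => |Q w.1|).bddAbove
  refine ⟨C, fun v => ?_⟩
  rw [← Q.apply_translate (-ZSpan.floor Γ.a v) v]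
  exact hC ⟨Γ.frac v, rfl⟩

lemma memLp_mul (f : Γ.L2) : Memℓp (fun v => (Q v : ℂ) * f v) 2 := by
  obtain ⟨C, hC⟩ := Q.exists_abs_le
  have hf : Summable fun v => ‖f v‖ ^ 2 := (Γ.memLp_two_iff f).1 (lp.memℓp f)
  rw [memLp_two_iff]
  refine Summable.of_nonneg_of_le (fun v => sq_nonneg _) (fun v => ?_) (hf.mul_left (C ^ 2))
  rw [norm_mul, mul_pow, Complex.norm_real, Real.norm_eq_abs]
  gcongr
  exact hC v

/-- The Schrödinger operator `H = A + Q` as a linear map on `ℓ²(Γ)`. -/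
def schrodingerLinear : Γ.L2 →ₗ[ℂ] Γ.L2 where
  toFun f := ⟨fun v => ∑ u ∈ Γ.nbrs v, f u + (Q v : ℂ) * f v,
    (Γ.memLp_adjacency f).add (Q.memLp_mul f)⟩
  map_add' f g := by
    ext v
    simp only [lp.coeFn_add, Pi.add_apply, Finset.sum_add_distrib, mul_add]
    ring
  map_smul' c f := by
    ext v
    simp only [lp.coeFn_smul, Pi.smul_apply, smul_eq_mul, RingHom.id_apply, Finset.mul_sum, mul_add]
    ring

/-- The Schrödinger operator `H = A + Q` on `ℓ²(Γ)`, where `A` is the adjacency operator: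
`(H f)(v) = ∑_{u ∼ v} f(u) + Q(v) f(v)`. It is bounded (closed graph theorem). -/
def schrodinger : Γ.L2 →L[ℂ] Γ.L2 :=
  ContinuousLinearMap.ofSeqClosedGraph (g := Q.schrodingerLinear) fun u x y hu hTu => by
    have hev : ∀ (v : Γ.V) {w : ℕ → Γ.L2} {z : Γ.L2}, Tendsto w atTop (nhds z) →
        Tendsto (fun n => w n v) atTop (nhds (z v)) := fun v w z h => by
      rw [tendsto_iff_norm_sub_tendsto_zero] at h ⊢
      refine squeeze_zero (fun _ => norm_nonneg _) (fun n => ?_) h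
      exact lp.norm_apply_le_norm (p := 2) (by simp) (w n - z) v
    ext v
    refine tendsto_nhds_unique (hev v hTu) ?_
    exact (tendsto_finsetSum _ fun w _ => hev w hu).add ((hev v hu).const_mul _)

lemma schrodinger_apply (f : Γ.L2) (v : Γ.V) :
    Q.schrodinger f v = ∑ u ∈ Γ.nbrs v, f u + (Q v : ℂ) * f v := rfl

/-- The unitary group `e^{-itH}`. -/
def evolution (t : ℝ) : Γ.L2 →L[ℂ] Γ.L2 :=
  NormedSpace.exp ((-(Complex.I * (t : ℂ))) • Q.schrodinger)

/-- The probability distribution `v ↦ |e^{-itH} ψ(v)|²` of the position at time `t`, as a measure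
on `ℝ^d ⊇ V`. -/
def positionLaw (ψ : Γ.L2) (t : ℝ) : Measure (EuclideanSpace ℝ (Fin d)) :=
  Measure.sum fun v : Γ.V =>
    ENNReal.ofReal (‖Q.evolution t ψ v‖ ^ 2) • Measure.dirac (v : EuclideanSpace ℝ (Fin d))

end PeriodicPotential

/-- The dual basis `b₁, …, b_d`, characterized by `aᵢ · bⱼ = 2π δᵢⱼ`. -/
def b (j : Fin d) : EuclideanSpace ℝ (Fin d) :=
  (2 * Real.pi) • (InnerProductSpace.toDual ℝ (EuclideanSpace ℝ (Fin d))).symm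
    (LinearMap.toContinuousLinearMap (Γ.a.coord j))

lemma inner_b (j : Fin d) (x : EuclideanSpace ℝ (Fin d)) :
    inner ℝ (Γ.b j) x = 2 * Real.pi * Γ.a.repr x j := by
  simp [b, inner_smul_left, InnerProductSpace.toDual_symm_apply]

lemma inner_a_b (i j : Fin d) : inner ℝ (Γ.a i) (Γ.b j) = if i = j then 2 * Real.pi else 0 := by
  rw [real_inner_comm, inner_b]
  simp [Finsupp.single_apply]

/-- `θ_b = ∑ θᵢ bᵢ`. -/
def dualVec (θ : Fin d → ℝ) : EuclideanSpace ℝ (Fin d) := ∑ i, θ i • Γ.b i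

/-- Lebesgue measure `dθ` on `[0,1)^d`. -/
def cellMeasure (d : ℕ) : Measure (Fin d → ℝ) :=
  volume.restrict (Set.univ.pi fun _ => Set.Ico 0 1)

instance (d : ℕ) : IsProbabilityMeasure (cellMeasure d) :=
  ⟨by simp [cellMeasure, Real.volume_pi_Ico]⟩

/-- The function `θ ↦ e^{-i θ_b · x}` in `L²([0,1)^d)`. -/
def planeWave (x : EuclideanSpace ℝ (Fin d)) : Lp ℂ 2 (cellMeasure d) :=
  MemLp.toLp (fun θ : Fin d → ℝ => Complex.exp (-(Complex.I * (inner ℝ (Γ.dualVec θ) x : ℝ)))) <|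
    MemLp.of_bound (by
      apply Continuous.aestronglyMeasurable
      unfold dualVec
      fun_prop) 1 (Eventually.of_forall fun θ => by
        rw [Complex.norm_exp]; simp)

/-- The Floquet transform of `ψ ∈ ℓ²(Γ)`,
`(Uψ)_{θ_b}(v) = ∑_{k ∈ ℤ^d} e^{-i θ_b · (v + k_a)} ψ(v + k_a)` for `v` in the unit crystal,
as a function of `θ ∈ [0,1)^d`. The series is an orthogonal one and is summed in `L²([0,1)^d)`. -/
def floquet (ψ : Γ.L2) (v : Γ.Cell) : Lp ℂ 2 (cellMeasure d) :=
  ∑' k : Fin d → ℤ, ψ (Γ.translate ⟨Γ.latticeVec k, Γ.latticeVec_mem k⟩ v.1) •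
    Γ.planeWave (v.1 + Γ.latticeVec k)

namespace PeriodicPotential

variable {Γ} (Q : Γ.PeriodicPotential)

open Classical in
/-- The matrix of the fiber operator `H(κ)` on `ℓ²(V_f)`,
`[H(κ) f](v) = ∑_{u ∼ v} e^{i κ · (u - v)} f({u}_a) + Q(v) f(v)`,
where `u` runs over the neighbours of `v` in the full graph. -/
def fiber (κ : EuclideanSpace ℝ (Fin d)) : Matrix Γ.Cell Γ.Cell ℂ := fun v w =>
  (∑ u ∈ (Γ.nbrs v.1).filter (fun u => Γ.frac u = w),
    Complex.exp (Complex.I * (inner ℝ κ ((u : EuclideanSpace ℝ (Fin d)) - v.1) : ℝ))) +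
  if v = w then (Q v.1 : ℂ) else 0

lemma fiber_mulVec (κ : EuclideanSpace ℝ (Fin d)) (f : Γ.Cell → ℂ) (v : Γ.Cell) :
    (Q.fiber κ *ᵥ f) v = ∑ u ∈ Γ.nbrs v.1,
      Complex.exp (Complex.I * (inner ℝ κ ((u : EuclideanSpace ℝ (Fin d)) - v.1) : ℝ))
        * f (Γ.frac u) + (Q v.1 : ℂ) * f v := by
  classical
  simp only [Matrix.mulVec, dotProduct, fiber, add_mul, Finset.sum_add_distrib, ite_mul, zero_mul,
    Finset.sum_ite_eq, Finset.mem_univ, if_true, Finset.sum_mul]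
  congr 1
  rw [← Finset.sum_fiberwise (Γ.nbrs v.1) Γ.frac]
  refine Finset.sum_congr rfl fun w _ => ?_
  refine Finset.sum_congr (by congr) fun u hu => ?_
  rw [(Finset.mem_filter.1 hu).2]

lemma fiber_isHermitian (κ : EuclideanSpace ℝ (Fin d)) : (Q.fiber κ).IsHermitian := by
  classical
  have hfl : ∀ {w : Γ.Cell} {u : Γ.V}, Γ.frac u = w →
      (u : EuclideanSpace ℝ (Fin d)) = w.1 + ZSpan.floor Γ.a (u : EuclideanSpace ℝ (Fin d)) := by
    rintro w u rfl
    simp [coe_frac, ZSpan.fract_apply]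
  have key : ∀ {v w : Γ.Cell} {u : Γ.V},
      u ∈ (Γ.nbrs v.1).filter (fun u => Γ.frac u = w) →
      Γ.translate (-ZSpan.floor Γ.a (u : EuclideanSpace ℝ (Fin d))) v.1 ∈
        (Γ.nbrs w.1).filter (fun u => Γ.frac u = v) := by
    intro v w u hu
    rw [Finset.mem_filter, mem_nbrs] at hu ⊢
    refine ⟨?_, by rw [frac_translate, frac_coe]⟩
    rw [← Γ.adj_translate_iff (ZSpan.floor Γ.a (u : EuclideanSpace ℝ (Fin d))),
      translate_translate, neg_add_cancel, translate_zero]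
    have : Γ.translate (ZSpan.floor Γ.a (u : EuclideanSpace ℝ (Fin d))) w.1 = u :=
      Subtype.ext (hfl hu.2).symm
    rw [this]
    exact hu.1.symm
  have hfloor : ∀ (v : Γ.Cell) (l : Γ.lattice),
      ZSpan.floor Γ.a (Γ.translate l v.1 : EuclideanSpace ℝ (Fin d)) = l := by
    intro v l
    have h := hfl (w := v) (u := Γ.translate l v.1) (by rw [frac_translate, frac_coe])
    rw [coe_translate] at h ⊢
    exact Subtype.ext (add_left_cancel h).symm
  ext v w
  rw [Matrix.conjTranspose_apply]
  simp only [fiber, star_add, star_sum]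
  congr 1
  · refine Finset.sum_bij'
      (fun u _ => Γ.translate (-ZSpan.floor Γ.a (u : EuclideanSpace ℝ (Fin d))) w.1)
      (fun u _ => Γ.translate (-ZSpan.floor Γ.a (u : EuclideanSpace ℝ (Fin d))) v.1)
      (fun u hu => key hu) (fun u hu => key hu) (fun u hu => ?_) (fun u hu => ?_) (fun u hu => ?_)
    · rw [hfloor, neg_neg]
      exact Subtype.ext (hfl (Finset.mem_filter.1 hu).2).symm
    · rw [hfloor, neg_neg]
      exact Subtype.ext (hfl (Finset.mem_filter.1 hu).2).symm
    · have h := hfl (Finset.mem_filter.1 hu).2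
      rw [Complex.star_def, ← Complex.exp_conj, map_mul, Complex.conj_I, Complex.conj_ofReal,
        coe_translate, neg_mul, ← mul_neg, ← Complex.ofReal_neg, ← inner_neg_right]
      congr 4
      conv_lhs => rw [h]
      simp
      abel
  · by_cases h : v = w
    · subst h; simp
    · simp [h, Ne.symm h]

/-- `E_n(θ_b)`, `n = 1, …, ν`: the eigenvalues of `H(θ_b)` in increasing order, counted with
multiplicity (`eigenvalues₀` lists them in decreasing order). -/
def bandFunction (n : Fin Γ.cellCard) (θ : Fin d → ℝ) : ℝ :=
  (Q.fiber_isHermitian (Γ.dualVec θ)).eigenvalues₀ n.rev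

/-- The velocity map `h(θ, n) = (2π)⁻¹ ∇_{θ_a} E_n(θ_b)`, with `∇_{θ_a} = ∑ᵢ aᵢ ∂_{θᵢ}`. -/
def velocity (p : (Fin d → ℝ) × Fin Γ.cellCard) : EuclideanSpace ℝ (Fin d) :=
  (2 * Real.pi)⁻¹ •
    ∑ i, lineDeriv ℝ (Q.bandFunction p.2) p.1 (Pi.single i 1) • Γ.a i

/-- A measurable choice of eigenprojections `P_n(θ_b)`, `n = 1, …, ν`, belonging to the eigenvalues
`E_n(θ_b)`: mutually orthogonal orthogonal projections (self-adjoint idempotents) with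
`∑ P_n(θ_b) = 1` and `H(θ_b) = ∑ E_n(θ_b) P_n(θ_b)`. Where the `E_n(θ_b)` are simple this
determines the `P_n(θ_b)`; where eigenvalues coincide any splitting of the eigenspace is allowed. -/
structure Eigenprojections where
  proj : Fin Γ.cellCard → (Fin d → ℝ) → Matrix Γ.Cell Γ.Cell ℂ
  measurable_proj : ∀ n v w, Measurable fun θ => proj n θ v w
  isHermitian : ∀ n θ, (proj n θ).IsHermitian
  idempotent : ∀ n θ, proj n θ * proj n θ = proj n θ
  orthogonal : ∀ m n θ, m ≠ n → proj m θ * proj n θ = 0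
  sum_eq_one : ∀ θ, ∑ n, proj n θ = 1
  spectral_decomposition : ∀ θ,
    Q.fiber (Γ.dualVec θ) = ∑ n, (Q.bandFunction n θ : ℂ) • proj n θ

namespace Eigenprojections

variable {Q} (P : Q.Eigenprojections)

/-- The measure `μ^ψ` on `[0,1)^d × {1, …, ν}`,
`∫ f dμ^ψ = ∫_{[0,1)^d} ∑_n f(θ, n) ‖P_n(θ_b) (Uψ)_{θ_b}‖² dθ`. -/
def bandMeasure (ψ : Γ.L2) :
    Measure ((Fin d → ℝ) × Fin Γ.cellCard) :=
  ((cellMeasure d).prod Measure.count).withDensity fun p =>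
    ENNReal.ofReal (∑ v, ‖(P.proj p.2 p.1 *ᵥ fun w => Γ.floquet ψ w p.1) v‖ ^ 2)

/-- The limiting distribution `ν_∞^ψ = h_* μ^ψ` on `ℝ^d`. -/
def limitLaw (ψ : Γ.L2) : Measure (EuclideanSpace ℝ (Fin d)) :=
  (P.bandMeasure ψ).map Q.velocity

end Eigenprojections

end PeriodicPotential

end PeriodicGraph

end

/-! The proof compares characteristic functions. Let `M_κ` be multiplication by `e^{iκ·v}`
(`modulate`). The characteristic function of `X_t/t` at `ξ` is `⟨e^{-itH}ψ, M_κ e^{-itH}ψ⟩` with `κ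
= ξ/t` (`charFun_positionLaw`). Since `M_{-κ}ψ → ψ` and the evolution is isometric, the last `ψ` may
be replaced by `M_{-κ}ψ`. The Floquet transform is an isometry that turns `H` into multiplication by
`H(θ_b)`, and `M_κ H M_{-κ}` into multiplication by `H(θ_b - κ)`. With `x = (Uψ)_{θ_b}` the quantity
becomes `∫ ⟨e^{-itH(θ_b)}x, e^{-itH(θ_b-κ)}x⟩ dθ`.

The core is the pointwise limit of this integrand (`tendsto_propagator`). With `η` the dual
coordinates of `ξ`, expanding in eigenprojections gives terms `e^{it(E_n(θ) - E_m(θ-η/t))} P_n(θ)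
P_m(θ-η/t)`. If `E_n(θ) ≠ E_m(θ)`, the product of projections tends to zero
(`tendsto_proj_mul_proj`). If they are equal, the phase tends to `e^{i∂_η E_n(θ)}`
(`tendsto_phase`), because touching bands have the same derivative wherever both are differentiable.
Summing over `m` leaves `∑ e^{i∂_η E_n(θ)} P_n(θ)`. No continuity of the projections and no analytic
perturbation theory is needed: Weyl's inequality makes the ordered bands Lipschitz, and Rademacher's
theorem gives differentiability almost everywhere. Dominated convergence, the identity `∂_η E_n =
h·ξ` and Lévy's continuity theorem finish the proof.

A measurable choice of eigenprojections comes from Lagrange interpolation, with the whole spectral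
projection of an eigenvalue assigned to its first index. -/

/-! ### Perturbation of ordered eigenvalues -/

/-- Weyl's inequality for the ordered eigenvalues of symmetric operators. -/
theorem LinearMap.IsSymmetric.eigenvalues_le_add {𝕜 E : Type*} [RCLike 𝕜] [NormedAddCommGroup E]
    [InnerProductSpace 𝕜 E] [FiniteDimensional 𝕜 E] {n : ℕ} (hn : Module.finrank 𝕜 E = n)
    {S T : E →ₗ[𝕜] E} (hS : S.IsSymmetric) (hT : T.IsSymmetric) {c : ℝ}
    (h : ∀ x, RCLike.re (inner 𝕜 x (T x)) ≤ RCLike.re (inner 𝕜 x (S x)) + c * ‖x‖ ^ 2) (i : Fin n) :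
    hT.eigenvalues hn i ≤ hS.eigenvalues hn i + c := by
  have quad : ∀ {R : E →ₗ[𝕜] E} (hR : R.IsSymmetric) (x : E), RCLike.re (inner 𝕜 x (R x)) =
      ∑ j, hR.eigenvalues hn j * ‖inner 𝕜 (hR.eigenvectorBasis hn j) x‖ ^ 2 := by
    intro R hR x
    rw [← (hR.eigenvectorBasis hn).sum_inner_mul_inner x (R x), map_sum]
    refine Finset.sum_congr rfl fun j _ => ?_
    rw [← hR, hR.apply_eigenvectorBasis, inner_smul_left, ← inner_conj_symm x]
    rw [RCLike.conj_ofReal, mul_left_comm, RCLike.conj_mul, RCLike.re_ofReal_mul]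
    norm_cast
  -- Eigenvalues are listed in decreasing order. A vector orthogonal to the `T`-eigenvectors after
  -- `i` and the `S`-eigenvectors before `i` has `T`-form at least the `i`-th eigenvalue of `T` and
  -- `S`-form at most that of `S`, times its squared norm. These are `n - 1` conditions, so a
  -- nonzero such vector exists.
  let b := fun j : {j : Fin n // j ≠ i} =>
    if i < j.1 then hT.eigenvectorBasis hn j.1 else hS.eigenvectorBasis hn j.1
  let L : E →ₗ[𝕜] ({j : Fin n // j ≠ i} → 𝕜) := LinearMap.pi fun j => innerₛₗ 𝕜 (b j)
  have hker : LinearMap.ker L ≠ ⊥ := by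
    apply LinearMap.ker_ne_bot_of_finrank_lt
    rw [hn, Module.finrank_fintype_fun_eq_card, Fintype.card_subtype_compl]
    simp
    exact i.pos
  obtain ⟨x, hx, hx0⟩ := Submodule.exists_mem_ne_zero_of_ne_bot hker
  have hb : ∀ j, inner 𝕜 (b j) x = 0 := fun j => by
    simpa [L] using congrFun (LinearMap.mem_ker.1 hx) j
  have nrm : ∀ {R : E →ₗ[𝕜] E} (hR : R.IsSymmetric),
      ‖x‖ ^ 2 = ∑ j, ‖inner 𝕜 (hR.eigenvectorBasis hn j) x‖ ^ 2 := fun hR =>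
    ((hR.eigenvectorBasis hn).sum_sq_norm_inner_right x).symm
  have h1 : hT.eigenvalues hn i * ‖x‖ ^ 2 ≤ RCLike.re (inner 𝕜 x (T x)) := by
    rw [quad hT, nrm hT, Finset.mul_sum]
    refine Finset.sum_le_sum fun j _ => ?_
    rcases le_or_gt j i with hj | hj
    · exact mul_le_mul_of_nonneg_right (hT.eigenvalues_antitone hn hj) (sq_nonneg _)
    · have := hb ⟨j, hj.ne'⟩
      simp only [b, hj, if_true] at this
      simp [this]
  have h2 : RCLike.re (inner 𝕜 x (S x)) ≤ hS.eigenvalues hn i * ‖x‖ ^ 2 := by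
    rw [quad hS, nrm hS, Finset.mul_sum]
    refine Finset.sum_le_sum fun j _ => ?_
    rcases le_or_gt i j with hj | hj
    · exact mul_le_mul_of_nonneg_right (hS.eigenvalues_antitone hn hj) (sq_nonneg _)
    · have := hb ⟨j, hj.ne⟩
      simp only [b, hj.not_gt, if_false] at this
      simp [this]
  have hpos : 0 < ‖x‖ ^ 2 := by positivity
  have := h x
  nlinarith

/-- The ordered eigenvalues of a Hermitian matrix depend on the entries in a Lipschitz way. -/
theorem Matrix.IsHermitian.abs_eigenvalues₀_sub_le {m : Type*} [Fintype m] [DecidableEq m]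
    {A B : Matrix m m ℂ} (hA : A.IsHermitian) (hB : B.IsHermitian) (i : Fin (Fintype.card m)) :
    |hA.eigenvalues₀ i - hB.eigenvalues₀ i| ≤ ∑ v, ∑ w, ‖A v w - B v w‖ := by
  have key : ∀ {A B : Matrix m m ℂ} (hA : A.IsHermitian) (hB : B.IsHermitian),
      hA.eigenvalues₀ i ≤ hB.eigenvalues₀ i + ∑ v, ∑ w, ‖A v w - B v w‖ := by
    intro A B hA hB
    refine LinearMap.IsSymmetric.eigenvalues_le_add _ _ _ (fun x => ?_) i
    rw [← sub_le_iff_le_add', ← map_sub, ← inner_sub_right, ← LinearMap.sub_apply, ← map_sub]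
    refine (RCLike.re_le_norm _).trans ?_
    simp only [PiLp.inner_apply, Matrix.toLpLin_apply, Matrix.mulVec, dotProduct, RCLike.inner_apply]
    refine (norm_sum_le _ _).trans ?_
    rw [Finset.sum_mul]
    refine Finset.sum_le_sum fun v _ => ?_
    rw [Finset.sum_mul, Finset.sum_mul]
    refine (norm_sum_le _ _).trans (Finset.sum_le_sum fun w _ => ?_)
    have h1 : ‖x v‖ ≤ ‖x‖ := PiLp.norm_apply_le x v
    have h2 : ‖x w‖ ≤ ‖x‖ := PiLp.norm_apply_le x w
    simp only [norm_mul, RCLike.norm_conj, Matrix.sub_apply]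
    calc ‖A v w - B v w‖ * ‖x w‖ * ‖x v‖ ≤ ‖A v w - B v w‖ * ‖x‖ * ‖x‖ := by gcongr
      _ = _ := by ring
  rw [abs_sub_le_iff]
  constructor
  · linarith [key hA hB]
  · have := key hB hA
    simp only [norm_sub_rev (B _ _)] at this
    linarith

/-! ### Dual coordinates and regularity of the band functions -/

namespace PeriodicGraph

variable {d : ℕ} (Γ : PeriodicGraph d)

lemma dualVec_sub (θ η : Fin d → ℝ) : Γ.dualVec (θ - η) = Γ.dualVec θ - Γ.dualVec η := by
  simp [dualVec, sub_smul]

lemma dualVec_zero : Γ.dualVec 0 = 0 := by simp [dualVec]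

lemma continuous_dualVec : Continuous Γ.dualVec := by
  unfold dualVec; fun_prop

lemma dualVec_smul (c : ℝ) (η : Fin d → ℝ) : Γ.dualVec (c • η) = c • Γ.dualVec η := by
  simp [dualVec, mul_smul, Finset.smul_sum]

lemma inner_dualVec (θ : Fin d → ℝ) (x : EuclideanSpace ℝ (Fin d)) :
    inner ℝ (Γ.dualVec θ) x = 2 * Real.pi * ∑ i, θ i * Γ.a.repr x i := by
  simp only [dualVec, sum_inner, inner_smul_left, inner_b, Finset.mul_sum]
  exact Finset.sum_congr rfl fun i _ => by simp; ring

/-- The coordinates of `ξ` in the dual basis. -/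
noncomputable def dualCoord (ξ : EuclideanSpace ℝ (Fin d)) : Fin d → ℝ :=
  fun i => (2 * Real.pi)⁻¹ * inner ℝ (Γ.a i) ξ

lemma dualVec_dualCoord (ξ : EuclideanSpace ℝ (Fin d)) : Γ.dualVec (Γ.dualCoord ξ) = ξ := by
  refine ext_inner_right ℝ fun x => ?_
  have hpi := Real.pi_ne_zero
  rw [inner_dualVec]
  conv_rhs => rw [← Γ.a.sum_repr x, inner_sum]
  rw [Finset.mul_sum]
  refine Finset.sum_congr rfl fun i _ => ?_
  rw [dualCoord, inner_smul_right, real_inner_comm]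
  field_simp

namespace PeriodicPotential

variable {Γ} (Q : Γ.PeriodicPotential)

lemma bandFunction_monotone (θ : Fin d → ℝ) : Monotone fun n => Q.bandFunction n θ :=
  fun _ _ h => (Q.fiber_isHermitian _).eigenvalues₀_antitone (Fin.rev_le_rev.2 h)

/-- Each entry is a finite sum of exponentials `e^{iκ·(u-v)}` plus a constant, and `|e^{ix} -
e^{iy}| ≤ |x - y|`. -/
lemma exists_norm_fiber_sub_le : ∃ C : NNReal, ∀ θ θ' : Fin d → ℝ,
    ∑ v, ∑ w, ‖Q.fiber (Γ.dualVec θ) v w - Q.fiber (Γ.dualVec θ') v w‖ ≤ C * dist θ θ' := by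
  classical
  have hentry : ∀ v w, ∃ C : NNReal, ∀ θ θ' : Fin d → ℝ,
      ‖Q.fiber (Γ.dualVec θ) v w - Q.fiber (Γ.dualVec θ') v w‖ ≤ C * dist θ θ' := by
    intro v w
    let c : Γ.V → NNReal := fun u => ∑ i, ‖Γ.b i‖₊ * ‖(u : EuclideanSpace ℝ (Fin d)) - v.1‖₊
    refine ⟨∑ u ∈ (Γ.nbrs v.1).filter (fun u => Γ.frac u = w), c u, fun θ θ' => ?_⟩
    simp only [fiber, add_sub_add_right_eq_sub, ← Finset.sum_sub_distrib]
    refine (norm_sum_le _ _).trans ?_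
    push_cast
    rw [Finset.sum_mul]
    refine Finset.sum_le_sum fun u _ => ?_
    have hexp : ∀ x y : ℝ, ‖Complex.exp (Complex.I * x) - Complex.exp (Complex.I * y)‖ ≤ |x - y| := by
      intro x y
      have h1 : Complex.exp (Complex.I * x) - Complex.exp (Complex.I * y) =
          Complex.exp (Complex.I * y) * (Complex.exp (Complex.I * (x - y : ℝ)) - 1) := by
        rw [mul_sub, ← Complex.exp_add]; push_cast; ring_nf
      rw [h1, norm_mul, mul_comm Complex.I, Complex.norm_exp_ofReal_mul_I, one_mul]
      exact (Real.norm_exp_I_mul_ofReal_sub_one_le (x := x - y)).trans_eq (Real.norm_eq_abs _)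
    refine (hexp _ _).trans ?_
    rw [← inner_sub_left, ← dualVec_sub]
    refine (abs_real_inner_le_norm _ _).trans ?_
    simp only [c, NNReal.coe_sum, NNReal.coe_mul, coe_nnnorm, ← Finset.sum_mul]
    rw [mul_right_comm]
    gcongr
    rw [dualVec, Finset.sum_mul]
    refine (norm_sum_le _ _).trans (Finset.sum_le_sum fun i _ => ?_)
    rw [norm_smul, mul_comm, dist_eq_norm]
    gcongr
    exact norm_le_pi_norm (θ - θ') i
  choose C hC using hentry
  refine ⟨∑ v, ∑ w, C v w, fun θ θ' => ?_⟩
  push_cast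
  simp only [Finset.sum_mul]
  exact Finset.sum_le_sum fun v _ => Finset.sum_le_sum fun w _ => hC v w θ θ'

lemma exists_lipschitzWith_bandFunction : ∃ C : NNReal, ∀ n, LipschitzWith C (Q.bandFunction n) := by
  obtain ⟨C, hC⟩ := Q.exists_norm_fiber_sub_le
  refine ⟨C, fun n => LipschitzWith.of_dist_le_mul fun θ θ' => ?_⟩
  rw [Real.dist_eq]
  exact (Matrix.IsHermitian.abs_eigenvalues₀_sub_le _ _ _).trans (hC θ θ')

lemma continuous_bandFunction (n : Fin Γ.cellCard) : Continuous (Q.bandFunction n) :=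
  let ⟨_, h⟩ := Q.exists_lipschitzWith_bandFunction
  (h n).continuous

lemma continuous_fiber (v w : Γ.Cell) : Continuous fun κ => Q.fiber κ v w := by
  unfold fiber; fun_prop

/-- Rademacher's theorem. The semiclassical limit is taken only at these points. -/
lemma ae_differentiableAt_bandFunction :
    ∀ᵐ θ, ∀ n, DifferentiableAt ℝ (Q.bandFunction n) θ := by
  obtain ⟨C, h⟩ := Q.exists_lipschitzWith_bandFunction
  exact ae_all_iff.2 fun n => (h n).ae_differentiableAt

lemma measurable_velocity : Measurable Q.velocity := by
  refine measurable_from_prod_countable_left fun n => ?_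
  unfold velocity
  refine Measurable.const_smul (M := ℝ) (Finset.measurable_fun_sum (M := EuclideanSpace ℝ (Fin d)) _ fun i _ => ?_) _
  -- `lineDeriv` is `0` where the derivative does not exist, so the velocity is a total function and
  -- measurable without exceptional set.
  exact (measurable_lineDeriv (Q.continuous_bandFunction n)).smul_const _

/-- The derivative of a band function, applied to the dual coordinates of `ξ`, is the scalar product
of `ξ` with the velocity. -/
lemma fderiv_bandFunction_dualCoord {θ : Fin d → ℝ} {n : Fin Γ.cellCard}
    (h : DifferentiableAt ℝ (Q.bandFunction n) θ) (ξ : EuclideanSpace ℝ (Fin d)) :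
    fderiv ℝ (Q.bandFunction n) θ (Γ.dualCoord ξ) = inner ℝ (Q.velocity (θ, n)) ξ := by
  conv_lhs => rw [← Finset.univ_sum_single (Γ.dualCoord ξ), map_sum]
  simp only [velocity, inner_smul_left, sum_inner, Finset.mul_sum]
  refine Finset.sum_congr rfl fun i _ => ?_
  rw [h.lineDeriv_eq_fderiv]
  have : (Pi.single i (Γ.dualCoord ξ i) : Fin d → ℝ) = Γ.dualCoord ξ i • Pi.single i 1 := by
    rw [← Pi.single_smul]; simp
  rw [this, map_smul, dualCoord]
  simp
  ring

end PeriodicPotential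
end PeriodicGraph

/-! ### Existence of measurable eigenprojections -/

namespace PeriodicGraph

variable {d : ℕ} {Γ : PeriodicGraph d}

namespace PeriodicPotential

variable (Q : Γ.PeriodicPotential)

open Classical in
/-- A factor of the Lagrange interpolation formula for the eigenprojection of the eigenvalue
`E_n(θ_b)`. -/
noncomputable def lagrangeFactor (n m : Fin Γ.cellCard) (θ : Fin d → ℝ) :
    Matrix Γ.Cell Γ.Cell ℂ :=
  if Q.bandFunction m θ = Q.bandFunction n θ then 1 else
    ((Q.bandFunction n θ - Q.bandFunction m θ : ℝ) : ℂ)⁻¹ •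
      (Q.fiber (Γ.dualVec θ) - (Q.bandFunction m θ : ℂ) • (1 : Matrix Γ.Cell Γ.Cell ℂ))

open Classical in
/-- The spectral projection of the eigenvalue `E_n(θ_b)` if `n` is the first index of this
eigenvalue, and `0` otherwise. -/
noncomputable def firstProj (n : Fin Γ.cellCard) (θ : Fin d → ℝ) : Matrix Γ.Cell Γ.Cell ℂ :=
  if ∃ m < n, Q.bandFunction m θ = Q.bandFunction n θ then 0 else
    ((List.finRange Γ.cellCard).map fun m => Q.lagrangeFactor n m θ).prod

lemma measurable_bandFunction (n : Fin Γ.cellCard) : Measurable (Q.bandFunction n) :=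
  (Q.continuous_bandFunction n).measurable

lemma measurable_lagrangeFactor (n m : Fin Γ.cellCard) (v w : Γ.Cell) :
    Measurable fun θ => Q.lagrangeFactor n m θ v w := by
  classical
  have h := fun n => Q.measurable_bandFunction n
  have hf : Measurable fun θ => Q.fiber (Γ.dualVec θ) v w :=
    ((Q.continuous_fiber v w).comp Γ.continuous_dualVec).measurable
  have : (fun θ => Q.lagrangeFactor n m θ v w) = fun θ =>
      if Q.bandFunction m θ = Q.bandFunction n θ then (1 : Matrix Γ.Cell Γ.Cell ℂ) v w else
      ((Q.bandFunction n θ - Q.bandFunction m θ : ℝ) : ℂ)⁻¹ *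
      (Q.fiber (Γ.dualVec θ) v w - (Q.bandFunction m θ : ℂ) * (1 : Matrix Γ.Cell Γ.Cell ℂ) v w) := by
    ext θ
    unfold lagrangeFactor
    split_ifs <;> simp
  rw [this]
  refine Measurable.ite (measurableSet_eq_fun (h m) (h n)) measurable_const ?_
  have h1 := h n
  have h2 := h m
  fun_prop

/-- The projection is a polynomial in the fiber whose coefficients are rational in the continuous
band functions, on pieces cut out by coincidences of bands. No selection of eigenvectors is
involved. -/
lemma measurable_firstProj (n : Fin Γ.cellCard) (v w : Γ.Cell) :
    Measurable fun θ => Q.firstProj n θ v w := by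
  classical
  have hprod : ∀ (l : List (Fin Γ.cellCard)) (v w : Γ.Cell),
      Measurable fun θ => (l.map fun m => Q.lagrangeFactor n m θ).prod v w := by
    intro l
    induction l with
    | nil => intro v w; simp
    | cons m l ih =>
      intro v w
      simp only [List.map_cons, List.prod_cons, Matrix.mul_apply]
      exact Finset.measurable_fun_sum _ fun u _ => (Q.measurable_lagrangeFactor n m v u).mul (ih u w)
  have : (fun θ => Q.firstProj n θ v w) = fun θ =>
      if ∃ m < n, Q.bandFunction m θ = Q.bandFunction n θ then 0 else
        ((List.finRange Γ.cellCard).map fun m => Q.lagrangeFactor n m θ).prod v w := by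
    ext θ
    unfold firstProj
    split_ifs <;> simp
  rw [this]
  refine Measurable.ite ?_ measurable_const (hprod _ v w)
  simp only [Set.ofPred_exists, Set.ofPred_and]
  exact MeasurableSet.iUnion fun m => (MeasurableSet.const _).inter
    (measurableSet_eq_fun (Q.measurable_bandFunction m) (Q.measurable_bandFunction n))

-- One unitary conjugation diagonalizes the fiber and all `firstProj n` at once, so the algebra of
-- the projections reduces to diagonals with entries `0` and `1`. A repeated eigenvalue repeats a
-- Lagrange factor, which is harmless: the factors are all `1` on the eigenspace of `E_n`, and on
-- any other eigenspace at least one is `0`.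
open Classical in
lemma exists_diagonalization (θ : Fin d → ℝ) :
    ∃ (φ : Matrix Γ.Cell Γ.Cell ℂ ≃⋆ₐ[ℂ] Matrix Γ.Cell Γ.Cell ℂ) (l : Γ.Cell → ℝ),
      Q.fiber (Γ.dualVec θ) = φ (Matrix.diagonal fun i => (l i : ℂ)) ∧
      (∀ i, ∃ n, Q.bandFunction n θ = l i) ∧
      ∀ n, Q.firstProj n θ = φ (Matrix.diagonal fun i =>
        if Q.bandFunction n θ = l i ∧ ∀ m < n, Q.bandFunction m θ ≠ Q.bandFunction n θ
          then 1 else 0) := by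
  have hA := Q.fiber_isHermitian (Γ.dualVec θ)
  let φ := Unitary.conjStarAlgAut ℂ (Matrix Γ.Cell Γ.Cell ℂ) hA.eigenvectorUnitary
  have h1 : Q.fiber (Γ.dualVec θ) = φ (Matrix.diagonal fun i => (hA.eigenvalues i : ℂ)) :=
    hA.spectral_theorem
  have h2 : ∀ i, ∃ n, Q.bandFunction n θ = hA.eigenvalues i := fun i =>
    ⟨((Fintype.equivOfCardEq (Fintype.card_fin _)).symm i).rev, by
      simp [bandFunction, Matrix.IsHermitian.eigenvalues]⟩
  refine ⟨φ, hA.eigenvalues, h1, h2, fun n => ?_⟩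
  have hfac : ∀ m, Q.lagrangeFactor n m θ = φ (Matrix.diagonal fun i =>
      if Q.bandFunction m θ = Q.bandFunction n θ then 1 else
        ((Q.bandFunction n θ - Q.bandFunction m θ : ℝ) : ℂ)⁻¹ *
          (hA.eigenvalues i - Q.bandFunction m θ)) := by
    intro m
    unfold lagrangeFactor
    split_ifs with h
    · rw [Matrix.diagonal_one, map_one]
    · conv_lhs => rw [h1, ← map_one φ, ← map_smul, ← map_sub, ← map_smul]
      congr 1
      ext i j
      rcases eq_or_ne i j with rfl | hij
      · simp
      · simp [hij]
  have hlist : ∀ l : List (Fin Γ.cellCard),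
      (l.map fun m => Q.lagrangeFactor n m θ).prod = φ (Matrix.diagonal fun i =>
        (l.map fun m => if Q.bandFunction m θ = Q.bandFunction n θ then 1 else
        ((Q.bandFunction n θ - Q.bandFunction m θ : ℝ) : ℂ)⁻¹ *
          (hA.eigenvalues i - Q.bandFunction m θ)).prod) := by
    intro l
    induction l with
    | nil => simp
    | cons m l ih =>
      simp only [List.map_cons, List.prod_cons, ih, hfac m]
      rw [← map_mul, Matrix.diagonal_mul_diagonal]
  unfold firstProj
  split_ifs with h
  · rw [show (fun i => if Q.bandFunction n θ = hA.eigenvalues i ∧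
      ∀ m < n, Q.bandFunction m θ ≠ Q.bandFunction n θ then (1 : ℂ) else 0) = fun _ => 0 from
      funext fun i => if_neg fun hc => by
        obtain ⟨m, hm, he⟩ := h
        exact hc.2 m hm he]
    simp
  · rw [hlist]
    congr 2
    ext i
    push Not at h
    by_cases hi : Q.bandFunction n θ = hA.eigenvalues i
    · rw [if_pos ⟨hi, h⟩]
      refine List.prod_eq_one fun x hx => ?_
      obtain ⟨m, -, rfl⟩ := List.mem_map.1 hx
      split_ifs with hm
      · rfl
      · rw [← hi, ← Complex.ofReal_sub]
        refine inv_mul_cancel₀ ?_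
        rw [Complex.ofReal_ne_zero, sub_ne_zero]
        exact Ne.symm hm
    -- The eigenvalue at position `i` is some `E_m` different from `E_n`, and the factor with index
    -- `m` vanishes there.
    · rw [if_neg fun hc => hi hc.1]
      refine List.prod_eq_zero (List.mem_map.2 ?_)
      obtain ⟨m, hm⟩ := h2 i
      exact ⟨m, List.mem_finRange m, by
        rw [if_neg (fun hc => hi (hc.symm.trans hm)), hm]; simp⟩

theorem nonempty_eigenprojections : Nonempty Q.Eigenprojections := by
  classical
  refine ⟨⟨Q.firstProj, Q.measurable_firstProj, fun n θ => ?_, fun n θ => ?_, fun m n θ hmn => ?_,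
    fun θ => ?_, fun θ => ?_⟩⟩ <;>
  obtain ⟨φ, l, h1, h2, h3⟩ := Q.exists_diagonalization θ
  · rw [Matrix.IsHermitian, ← Matrix.star_eq_conjTranspose, h3, ← map_star,
      Matrix.star_eq_conjTranspose, Matrix.diagonal_conjTranspose]
    congr 2
    ext i
    simp [apply_ite]
  · rw [h3, ← map_mul, Matrix.diagonal_mul_diagonal]
    simp
  · rw [h3, h3, ← map_mul, Matrix.diagonal_mul_diagonal]
    convert map_zero φ
    rw [← Matrix.diagonal_zero]
    congr 1
    ext i
    rw [mul_eq_zero]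
    by_contra! hc
    obtain ⟨⟨hm1, hm2⟩, -⟩ := ite_ne_right_iff.1 hc.1
    obtain ⟨⟨hn1, hn2⟩, -⟩ := ite_ne_right_iff.1 hc.2
    rcases lt_or_gt_of_ne hmn with h | h
    · exact hn2 m h (hm1.trans hn1.symm)
    · exact hm2 n h (hn1.trans hm1.symm)
  all_goals
    -- At each diagonal position exactly one projection has entry `1`: the one whose index is the
    -- smallest with that eigenvalue.
    have key : ∀ i, ∃ n, ∀ n', (Q.bandFunction n' θ = l i ∧
        ∀ m < n', Q.bandFunction m θ ≠ Q.bandFunction n' θ) ↔ n' = n := by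
      intro i
      have hne : (Finset.univ.filter fun n => Q.bandFunction n θ = l i).Nonempty := by
        obtain ⟨n, hn⟩ := h2 i
        exact ⟨n, by simp [hn]⟩
      have hmem := Finset.min'_mem _ hne
      have hle := fun n' h => Finset.min'_le (Finset.univ.filter fun n => Q.bandFunction n θ = l i) n' h
      simp only [Finset.mem_filter, Finset.mem_univ, true_and] at hmem hle
      refine ⟨Finset.min' _ hne, fun n' => ⟨fun h => ?_, ?_⟩⟩
      · refine le_antisymm (not_lt.1 fun hlt => h.2 _ hlt (hmem.trans h.1.symm)) (hle _ h.1)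
      · rintro rfl
        exact ⟨hmem, fun m hm he => absurd (hle m (he.trans hmem)) (not_le.2 hm)⟩
  · simp only [h3]
    rw [← map_sum, ← map_one φ]
    congr 1
    ext i j
    rw [Matrix.sum_apply]
    rcases eq_or_ne i j with rfl | hij
    · obtain ⟨n, hn⟩ := key i
      simp [hn]
    · simp [hij]
  · simp only [h3, ← map_smul]
    rw [← map_sum, h1]
    congr 1
    ext i j
    rw [Matrix.sum_apply]
    rcases eq_or_ne i j with rfl | hij
    · obtain ⟨n, hn⟩ := key i
      have := ((hn n).2 rfl).1
      simp [hn, this]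
    · simp [hij]

end PeriodicPotential
end PeriodicGraph

/-! ### The Floquet transform as an isometry -/

/-- A limit in `L²` that is also a pointwise limit almost everywhere. -/
theorem MeasureTheory.Lp.ae_eq_of_tendsto {α : Type*} [MeasurableSpace α] {μ : Measure α}
    {f : ℕ → Lp ℂ 2 μ} {g : Lp ℂ 2 μ} {g' : α → ℂ} (h : Tendsto f atTop (nhds g))
    (h' : ∀ᵐ x ∂μ, Tendsto (fun n => f n x) atTop (nhds (g' x))) : g =ᵐ[μ] g' := by
  obtain ⟨φ, hφ, hlim⟩ := (tendstoInMeasure_of_tendsto_Lp h).exists_seq_tendsto_ae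
  filter_upwards [hlim, h'] with x h1 h2
  exact tendsto_nhds_unique h1 (h2.comp hφ.tendsto_atTop)

namespace PeriodicGraph

variable {d : ℕ} (Γ : PeriodicGraph d)

lemma repr_latticeVec (k : Fin d → ℤ) (i : Fin d) : Γ.a.repr (Γ.latticeVec k) i = k i := by
  have : Γ.latticeVec k = ∑ i, (k i : ℝ) • Γ.a i := by
    simp [latticeVec, ← Int.cast_smul_eq_zsmul ℝ]
  rw [this, Γ.a.repr_sum_self]

lemma latticeVec_injective : Function.Injective Γ.latticeVec := fun k k' h => by
  ext i
  have := congrArg (fun x => Γ.a.repr x i) h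
  simpa only [repr_latticeVec, Int.cast_inj] using this

lemma exists_latticeVec_eq {l : EuclideanSpace ℝ (Fin d)} (hl : l ∈ Γ.lattice) :
    ∃ k, Γ.latticeVec k = l := by
  refine Γ.lattice_induction (p := fun l => ∃ k, Γ.latticeVec k = l) ⟨0, by simp [latticeVec]⟩
    (fun i => ⟨Pi.single i 1, by simp [latticeVec, Pi.single_apply]⟩) ?_ ?_ hl
  · rintro _ _ ⟨k, rfl⟩ ⟨k', rfl⟩
    exact ⟨k + k', by simp [latticeVec, add_smul, Finset.sum_add_distrib]⟩
  · rintro _ ⟨k, rfl⟩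
    exact ⟨-k, by simp [latticeVec]⟩

lemma integral_exp_cell (k : Fin d → ℤ) :
    ∫ θ : Fin d → ℝ, Complex.exp (Complex.I * (2 * Real.pi * ∑ i, θ i * k i : ℝ)) ∂cellMeasure d =
      if k = 0 then 1 else 0 := by
  have hone : ∀ n : ℤ, ∫ x in Set.Ico (0 : ℝ) 1, Complex.exp (Complex.I * (2 * Real.pi * (x * n) : ℝ))
      = if n = 0 then 1 else 0 := by
    intro n
    rw [integral_Ico_eq_integral_Ioc, ← intervalIntegral.integral_of_le zero_le_one]
    split_ifs with hn
    · simp [hn]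
    · have hc : (Complex.I * (2 * Real.pi * n)) ≠ 0 := by
        simp [Real.pi_ne_zero, hn]
      have := integral_exp_mul_complex (a := 0) (b := 1) hc
      rw [show (fun x : ℝ => Complex.exp (Complex.I * (2 * Real.pi * (x * n) : ℝ))) =
        fun x : ℝ => Complex.exp (Complex.I * (2 * Real.pi * n) * x) by
          ext x; push_cast; ring_nf, this]
      have h1 : Complex.exp (Complex.I * (2 * Real.pi * n)) = 1 := by
        rw [Complex.exp_eq_one_iff]
        exact ⟨n, by ring⟩
      simp [h1]
  have hprod : ∀ θ : Fin d → ℝ, Complex.exp (Complex.I * (2 * Real.pi * ∑ i, θ i * k i : ℝ)) =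
      ∏ i, Complex.exp (Complex.I * (2 * Real.pi * (θ i * k i) : ℝ)) := by
    intro θ
    rw [← Complex.exp_sum, ← Finset.mul_sum, Finset.mul_sum]
    push_cast
    rfl
  simp_rw [hprod]
  rw [cellMeasure, volume_pi, Measure.restrict_pi_pi,
    integral_fintype_prod_eq_prod (fun i (x : ℝ) =>
      Complex.exp (Complex.I * (2 * Real.pi * (x * k i) : ℝ)))]
  simp_rw [hone]
  split_ifs with hk
  · simp [hk]
  · obtain ⟨i, hi⟩ := Function.ne_iff.1 hk
    exact Finset.prod_eq_zero (Finset.mem_univ i) (if_neg hi)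

lemma coeFn_planeWave (x : EuclideanSpace ℝ (Fin d)) : Γ.planeWave x =ᵐ[cellMeasure d]
    fun θ => Complex.exp (-(Complex.I * (inner ℝ (Γ.dualVec θ) x : ℝ))) :=
  MemLp.coeFn_toLp _

/-- Plane waves at points differing by a period have as quotient a character of the torus, whose
integral is `integral_exp_cell`. -/
lemma inner_planeWave (x : EuclideanSpace ℝ (Fin d)) (k : Fin d → ℤ) :
    inner ℂ (Γ.planeWave (x + Γ.latticeVec k)) (Γ.planeWave x) = if k = 0 then 1 else 0 := by
  rw [L2.inner_def, ← integral_exp_cell k]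
  refine integral_congr_ae ?_
  filter_upwards [Γ.coeFn_planeWave (x + Γ.latticeVec k), Γ.coeFn_planeWave x] with θ h1 h2
  rw [h1, h2, RCLike.inner_apply, ← Complex.exp_conj, ← Complex.exp_add]
  have : inner ℝ (Γ.dualVec θ) (Γ.latticeVec k) = 2 * Real.pi * ∑ i, θ i * k i := by
    rw [inner_dualVec]; simp only [repr_latticeVec]
  rw [← this, inner_add_right]
  congr 1
  simp
  ring

/-- The Hilbert space `L²([0,1)^d; ℂ^{V_f})`. -/
abbrev FloquetSpace : Type := PiLp 2 fun _ : Γ.Cell => Lp ℂ 2 (cellMeasure d)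

/-- The Floquet transform of the delta function at the vertex `u`. -/
noncomputable def floquetVec (u : Γ.V) : Γ.FloquetSpace :=
  WithLp.toLp 2 (Pi.single (Γ.frac u) (Γ.planeWave u))

lemma floquetVec_apply (u : Γ.V) (v : Γ.Cell) :
    Γ.floquetVec u v = if Γ.frac u = v then Γ.planeWave u else 0 := by
  simp only [floquetVec, Pi.single_apply, eq_comm]

lemma exists_latticeVec_of_frac_eq {u u' : Γ.V} (h : Γ.frac u = Γ.frac u') :
    ∃ k, (u : EuclideanSpace ℝ (Fin d)) = u' + Γ.latticeVec k := by
  have h1 := congrArg (fun w : Γ.Cell => (w.1 : EuclideanSpace ℝ (Fin d))) h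
  simp only [coe_frac, ZSpan.fract_apply] at h1
  obtain ⟨k, hk⟩ := Γ.exists_latticeVec_eq
    (sub_mem (ZSpan.floor Γ.a (u : EuclideanSpace ℝ (Fin d))).2
      (ZSpan.floor Γ.a (u' : EuclideanSpace ℝ (Fin d))).2)
  refine ⟨k, ?_⟩
  rw [hk, ← sub_eq_iff_eq_add']
  rw [sub_eq_sub_iff_add_eq_add] at h1
  rw [sub_eq_sub_iff_add_eq_add, h1, add_comm]

/-- Vertices with different fractional parts sit in different components; those with the same one
differ by a period, where `inner_planeWave` applies. -/
lemma orthonormal_floquetVec : Orthonormal ℂ Γ.floquetVec := by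
  rw [orthonormal_iff_ite]
  intro u u'
  simp only [PiLp.inner_apply, floquetVec_apply]
  rw [Finset.sum_eq_single (Γ.frac u')]
  · by_cases h : Γ.frac u = Γ.frac u'
    · obtain ⟨k, hk⟩ := Γ.exists_latticeVec_of_frac_eq h
      rw [if_pos h, if_pos rfl, hk, inner_planeWave]
      refine if_congr ⟨?_, ?_⟩ rfl rfl
      · rintro rfl
        exact Subtype.ext (by simpa [latticeVec] using hk)
      · rintro rfl
        refine Γ.latticeVec_injective ?_
        rw [left_eq_add.1 hk]
        simp [latticeVec]
    · rw [if_neg h, inner_zero_left, if_neg (fun he => h (congrArg _ he))]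
  · intro w _ hw
    rw [if_neg (Ne.symm hw), inner_zero_right]
  · simp

/-- The Floquet transform as an isometry. -/
noncomputable def floquetIso : Γ.L2 →ₗᵢ[ℂ] Γ.FloquetSpace :=
  Γ.orthonormal_floquetVec.orthogonalFamily.linearIsometry

lemma floquetIso_single [DecidableEq Γ.V] (u : Γ.V) (c : ℂ) :
    Γ.floquetIso (lp.single 2 u c) = c • Γ.floquetVec u := by
  simp [floquetIso, OrthogonalFamily.linearIsometry_apply_single]

/-- The component at `v` of `∑ ψ(u) floquetVec u` sees only the vertices `v + k_a`. Reindexing by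
`k` gives the defining series and shows that it converges, so its `tsum` is not a default value. -/
lemma floquetIso_apply (ψ : Γ.L2) (v : Γ.Cell) : Γ.floquetIso ψ v = Γ.floquet ψ v := by
  have h1 : HasSum (fun u => ψ u • Γ.floquetVec u) (Γ.floquetIso ψ) := by
    have := Γ.orthonormal_floquetVec.orthogonalFamily.hasSum_linearIsometry ψ
    simp only [LinearIsometry.toSpanSingleton_apply] at this
    exact this
  have h2 := h1.mapL (PiLp.proj (𝕜 := ℂ) 2 (fun _ : Γ.Cell => Lp ℂ 2 (cellMeasure d)) v)
  let g : (Fin d → ℤ) → Γ.V := fun k => Γ.translate ⟨Γ.latticeVec k, Γ.latticeVec_mem k⟩ v.1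
  have hg : Function.Injective g := fun k k' h => Γ.latticeVec_injective
    (add_left_cancel (congrArg Subtype.val h))
  rw [← hg.hasSum_iff] at h2
  · rw [floquet, ← PiLp.proj_apply (𝕜 := ℂ) 2 (fun _ : Γ.Cell => Lp ℂ 2 (cellMeasure d)),
      ← h2.tsum_eq]
    refine tsum_congr fun k => ?_
    have : Γ.frac (g k) = v := by simp only [g]; rw [frac_translate, frac_coe]
    simp [floquetVec_apply, this, g]
  · intro u hu
    have : Γ.frac u ≠ v := by
      intro h
      obtain ⟨k, hk⟩ := Γ.exists_latticeVec_of_frac_eq (h.trans (Γ.frac_coe v).symm)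
      exact hu ⟨k, Subtype.ext hk.symm⟩
    simp [floquetVec_apply, this]

/-- Multiplication by the character `v ↦ e^{i κ · v}`. -/
noncomputable def modulate (κ : EuclideanSpace ℝ (Fin d)) : Γ.L2 →ₗᵢ[ℂ] Γ.L2 where
  toFun f := ⟨fun v => Complex.exp (Complex.I * (inner ℝ κ (v : EuclideanSpace ℝ (Fin d)) : ℝ)) * f v,
    (Γ.memLp_two_iff _).2 (by simpa [Complex.norm_exp] using (Γ.memLp_two_iff f).1 (lp.memℓp f))⟩
  map_add' f g := by ext v; exact mul_add _ _ _
  map_smul' c f := by ext v; exact mul_left_comm _ _ _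
  norm_map' f := by
    rw [lp.norm_eq_tsum_rpow (by simp), lp.norm_eq_tsum_rpow (by simp)]
    simp [Complex.norm_exp]

lemma modulate_apply (κ : EuclideanSpace ℝ (Fin d)) (f : Γ.L2) (v : Γ.V) : Γ.modulate κ f v =
    Complex.exp (Complex.I * (inner ℝ κ (v : EuclideanSpace ℝ (Fin d)) : ℝ)) * f v := rfl

lemma modulate_zero (f : Γ.L2) : Γ.modulate 0 f = f := by
  ext v; simp [modulate_apply]

lemma modulate_single [DecidableEq Γ.V] (κ : EuclideanSpace ℝ (Fin d)) (u : Γ.V) (c : ℂ) :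
    Γ.modulate κ (lp.single 2 u c) = lp.single 2 u
      (Complex.exp (Complex.I * (inner ℝ κ (u : EuclideanSpace ℝ (Fin d)) : ℝ)) * c) := by
  ext v
  rw [modulate_apply]
  rcases eq_or_ne v u with rfl | h
  · simp
  · simp [h]

/-- The Floquet transform of the modulated function. -/
noncomputable def floquetShift (κ : EuclideanSpace ℝ (Fin d)) : Γ.L2 →ₗᵢ[ℂ] Γ.FloquetSpace :=
  Γ.floquetIso.comp (Γ.modulate κ)

lemma floquetShift_zero : Γ.floquetShift 0 = Γ.floquetIso := by
  ext1 f
  simp [floquetShift, modulate_zero]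

lemma floquetShift_single [DecidableEq Γ.V] (κ : EuclideanSpace ℝ (Fin d)) (u : Γ.V) (c : ℂ) :
    Γ.floquetShift κ (lp.single 2 u c) =
      (Complex.exp (Complex.I * (inner ℝ κ (u : EuclideanSpace ℝ (Fin d)) : ℝ)) * c) •
        Γ.floquetVec u := by
  change Γ.floquetIso (Γ.modulate κ _) = _
  rw [modulate_single, floquetIso_single]

lemma inner_floquetShift (κ : EuclideanSpace ℝ (Fin d)) (f g : Γ.L2) :
    inner ℂ (Γ.floquetIso f) (Γ.floquetShift κ g) = inner ℂ f (Γ.modulate κ g) := by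
  exact Γ.floquetIso.inner_map_map _ _

/-! ### The Floquet transform intertwines the Schrödinger operator with its fibers -/

namespace PeriodicPotential

variable {Γ} (Q : Γ.PeriodicPotential)

open Classical in
/-- The columns of the fiber matrix, extended to a Bloch function. -/
lemma fiber_frac_mul_exp (σ : EuclideanSpace ℝ (Fin d)) (v : Γ.Cell) (u : Γ.V) :
    Q.fiber σ v (Γ.frac u) *
        Complex.exp (-(Complex.I * (inner ℝ σ (u : EuclideanSpace ℝ (Fin d)) : ℝ))) =
      ∑ w ∈ (Γ.nbrs u).filter (fun w => Γ.frac w = v),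
        Complex.exp (-(Complex.I * (inner ℝ σ (w : EuclideanSpace ℝ (Fin d)) : ℝ))) +
      if Γ.frac u = v then (Q u : ℂ) *
        Complex.exp (-(Complex.I * (inner ℝ σ (u : EuclideanSpace ℝ (Fin d)) : ℝ))) else 0 := by
  set l := ZSpan.floor Γ.a (u : EuclideanSpace ℝ (Fin d)) with hl
  have hu : Γ.translate (-l) u = (Γ.frac u).1 := rfl
  have hu' : Γ.translate l (Γ.frac u).1 = u := by
    rw [← hu, translate_translate]; simp [translate_zero]
  -- Hermitian symmetry turns the entry into a sum over the neighbours of `{u}_a`, which translation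
  -- by `l` carries to the neighbours of `u`.
  rw [← (Q.fiber_isHermitian σ).apply, fiber, star_add, add_mul]
  congr 1
  · rw [star_sum, Finset.sum_mul]
    refine Finset.sum_nbij' (Γ.translate l) (Γ.translate (-l)) (fun w hw => ?_) (fun w hw => ?_)
      (fun w _ => ?_) (fun w _ => ?_) (fun w _ => ?_)
    · rw [Finset.mem_filter, mem_nbrs] at hw ⊢
      rw [frac_translate]
      refine ⟨?_, hw.2⟩
      rw [← Γ.adj_translate_iff l, hu'] at hw
      exact hw.1
    · rw [Finset.mem_filter, mem_nbrs] at hw ⊢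
      rw [frac_translate]
      refine ⟨?_, hw.2⟩
      rw [← Γ.adj_translate_iff (-l), hu] at hw
      exact hw.1
    · simp [translate_translate, translate_zero]
    · simp [translate_translate, translate_zero]
    · rw [Complex.star_def, ← Complex.exp_conj, ← Complex.exp_add]
      have hc : inner ℝ σ (u : EuclideanSpace ℝ (Fin d)) =
          inner ℝ σ ((Γ.frac u).1 : EuclideanSpace ℝ (Fin d)) +
            inner ℝ σ (l : EuclideanSpace ℝ (Fin d)) := by
        rw [← inner_add_right, ← coe_translate, hu']
      rw [hc]
      congr 1
      simp only [map_mul, Complex.conj_I, Complex.conj_ofReal, coe_translate, inner_sub_right,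
        inner_add_right]
      push_cast
      ring
  · split_ifs with h
    · have : Q (Γ.frac u).1 = Q u := Q.apply_translate (-l) u
      simp [this]
    · simp

lemma memLp_fiber (κ : EuclideanSpace ℝ (Fin d)) (v w : Γ.Cell) :
    MemLp (fun θ => Q.fiber (Γ.dualVec θ - κ) v w) ∞ (cellMeasure d) := by
  classical
  refine memLp_top_of_bound (C := (Γ.nbrs v.1).card + |Q v.1|) ?_ (Eventually.of_forall fun θ => ?_)
  · exact ((Q.continuous_fiber v w).comp
      (Γ.continuous_dualVec.sub continuous_const)).aestronglyMeasurable
  · unfold fiber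
    refine (norm_add_le _ _).trans (add_le_add ?_ ?_)
    · refine (norm_sum_le _ _).trans ?_
      simp only [mul_comm Complex.I, Complex.norm_exp_ofReal_mul_I, Finset.sum_const, nsmul_eq_mul,
        mul_one, Nat.cast_le]
      exact Finset.card_filter_le _ _
    · split_ifs <;> simp

lemma schrodinger_single [DecidableEq Γ.V] (u : Γ.V) (c : ℂ) :
    Q.schrodinger (lp.single 2 u c) =
      ∑ w ∈ Γ.nbrs u, lp.single 2 w c + (Q u : ℂ) • lp.single 2 u c := by
  ext v
  rw [schrodinger_apply]
  simp only [lp.coeFn_add, lp.coeFn_sum, lp.coeFn_smul, Pi.add_apply, Finset.sum_apply,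
    Pi.smul_apply, smul_eq_mul, lp.single_apply, Pi.single_apply, Finset.sum_ite_eq,
    Finset.sum_ite_eq', mul_ite, mul_zero]
  congr 1
  · exact if_congr (by rw [mem_nbrs, mem_nbrs, Γ.graph.adj_comm]) rfl rfl
  · split_ifs with h
    · rw [h]
    · rfl

/-- Multiplication by the fiber operators, on functions of the quasimomentum. -/
noncomputable def fiberEntryL (κ : EuclideanSpace ℝ (Fin d)) (v w : Γ.Cell) :
    Lp ℂ 2 (cellMeasure d) →L[ℂ] Lp ℂ 2 (cellMeasure d) :=
  (ContinuousLinearMap.mul ℂ ℂ).holderL (cellMeasure d) ∞ 2 2 ((Q.memLp_fiber κ v w).toLp _)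

lemma coeFn_fiberEntryL (κ : EuclideanSpace ℝ (Fin d)) (v w : Γ.Cell)
    (f : Lp ℂ 2 (cellMeasure d)) : Q.fiberEntryL κ v w f =ᵐ[cellMeasure d]
      fun θ => Q.fiber (Γ.dualVec θ - κ) v w * f θ := by
  refine ((ContinuousLinearMap.mul ℂ ℂ).coeFn_holder
    ((Q.memLp_fiber κ v w).toLp _) f).trans ?_
  filter_upwards [(Q.memLp_fiber κ v w).coeFn_toLp] with θ h
  simp [h]

/-- Both sides are continuous and linear in `φ`, so delta functions suffice, and for these the claim
is `fiber_frac_mul_exp`. The modulation moves the quasimomentum to `θ_b - κ`; placing the shift in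
the fiber operator avoids translating functions of `θ` out of the unit cell. -/
lemma floquetShift_schrodinger_apply (κ : EuclideanSpace ℝ (Fin d)) (φ : Γ.L2) (v : Γ.Cell) :
    Γ.floquetShift κ (Q.schrodinger φ) v =
      ∑ w, Q.fiberEntryL κ v w (Γ.floquetShift κ φ w) := by
  classical
  let pr := fun w => PiLp.proj (𝕜 := ℂ) 2 (fun _ : Γ.Cell => Lp ℂ 2 (cellMeasure d)) w
  let W := (Γ.floquetShift κ).toContinuousLinearMap
  let L1 : Γ.L2 →L[ℂ] Lp ℂ 2 (cellMeasure d) := (pr v).comp (W.comp Q.schrodinger)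
  let L2 : Γ.L2 →L[ℂ] Lp ℂ 2 (cellMeasure d) :=
    ∑ w, (Q.fiberEntryL κ v w).comp ((pr w).comp W)
  suffices h : ∀ u c, L1 (lp.single 2 u c) = L2 (lp.single 2 u c) by
    have hs := lp.hasSum_single (p := 2) (by simp) φ
    have h1 := hs.mapL L1
    have h2 := hs.mapL L2
    simp only [h] at h1
    have := h1.unique h2
    simpa [L1, L2, pr, W] using this
  intro u c
  have e1 : L1 (lp.single 2 u c) = ∑ w ∈ (Γ.nbrs u).filter (fun w => Γ.frac w = v),
      (Complex.exp (Complex.I * (inner ℝ κ (w : EuclideanSpace ℝ (Fin d)) : ℝ)) * c) •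
        Γ.planeWave w + if Γ.frac u = v then
      ((Q u : ℂ) * (Complex.exp (Complex.I * (inner ℝ κ (u : EuclideanSpace ℝ (Fin d)) : ℝ)) * c)) •
        Γ.planeWave u else 0 := by
    simp only [L1, ContinuousLinearMap.comp_apply, schrodinger_single, map_add, map_sum, map_smul, W,
      LinearIsometry.coe_toContinuousLinearMap, floquetShift_single, pr, PiLp.proj_apply,
      floquetVec_apply, Finset.sum_filter, mul_smul, smul_ite, smul_zero]
  have e2 : L2 (lp.single 2 u c) = Q.fiberEntryL κ v (Γ.frac u)
      ((Complex.exp (Complex.I * (inner ℝ κ (u : EuclideanSpace ℝ (Fin d)) : ℝ)) * c) •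
        Γ.planeWave u) := by
    simp only [L2, _root_.sum_apply, ContinuousLinearMap.comp_apply, W,
      LinearIsometry.coe_toContinuousLinearMap, floquetShift_single, pr, map_smul, PiLp.proj_apply,
      floquetVec_apply]
    rw [Finset.sum_eq_single (Γ.frac u)]
    · simp
    · intro w _ hw
      simp [Ne.symm hw]
    · simp
  -- A modulated plane wave is the plane wave of the shifted quasimomentum.
  have phase : ∀ (θ : Fin d → ℝ) (w : EuclideanSpace ℝ (Fin d)),
      Complex.exp (Complex.I * (inner ℝ κ w : ℝ)) *
        Complex.exp (-(Complex.I * (inner ℝ (Γ.dualVec θ) w : ℝ))) =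
      Complex.exp (-(Complex.I * (inner ℝ (Γ.dualVec θ - κ) w : ℝ))) := by
    intro θ w
    rw [← Complex.exp_add, inner_sub_left]
    congr 1
    push_cast
    ring
  rw [e1, e2]
  refine Lp.ext ?_
  have hpw : ∀ᵐ θ ∂cellMeasure d, ∀ w ∈ insert u (Γ.nbrs u), Γ.planeWave w θ =
      Complex.exp (-(Complex.I * (inner ℝ (Γ.dualVec θ) (w : EuclideanSpace ℝ (Fin d)) : ℝ))) :=
    (Finset.eventually_all _).2 fun w _ => Γ.coeFn_planeWave w
  have hsm : ∀ᵐ θ ∂cellMeasure d, ∀ w ∈ Γ.nbrs u,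
      ((Complex.exp (Complex.I * (inner ℝ κ (w : EuclideanSpace ℝ (Fin d)) : ℝ)) * c) •
        Γ.planeWave w) θ =
      (Complex.exp (Complex.I * (inner ℝ κ (w : EuclideanSpace ℝ (Fin d)) : ℝ)) * c) *
        Γ.planeWave w θ :=
    (Finset.eventually_all _).2 fun w _ => Lp.coeFn_smul _ _
  have hsu := Lp.coeFn_smul
    (Complex.exp (Complex.I * (inner ℝ κ (u : EuclideanSpace ℝ (Fin d)) : ℝ)) * c) (Γ.planeWave u)
  have hsu' := Lp.coeFn_smul ((Q u : ℂ) *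
    (Complex.exp (Complex.I * (inner ℝ κ (u : EuclideanSpace ℝ (Fin d)) : ℝ)) * c)) (Γ.planeWave u)
  filter_upwards [hpw, hsm, hsu, hsu', Q.coeFn_fiberEntryL κ v (Γ.frac u)
      ((Complex.exp (Complex.I * (inner ℝ κ (u : EuclideanSpace ℝ (Fin d)) : ℝ)) * c) •
        Γ.planeWave u), Lp.coeFn_add (∑ w ∈ (Γ.nbrs u).filter (fun w => Γ.frac w = v),
      (Complex.exp (Complex.I * (inner ℝ κ (w : EuclideanSpace ℝ (Fin d)) : ℝ)) * c) •
        Γ.planeWave w) (if Γ.frac u = v then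
      ((Q u : ℂ) * (Complex.exp (Complex.I * (inner ℝ κ (u : EuclideanSpace ℝ (Fin d)) : ℝ)) * c)) •
        Γ.planeWave u else 0), Lp.coeFn_zero ℂ 2 (cellMeasure d),
      Lp.coeFn_fun_finsetSum ((Γ.nbrs u).filter (fun w => Γ.frac w = v)) fun w : Γ.V =>
      (Complex.exp (Complex.I * (inner ℝ κ (w : EuclideanSpace ℝ (Fin d)) : ℝ)) * c) •
        Γ.planeWave w] with θ h1 h2 h3 h4 h5 h6 h7 h8
  rw [h6, h5, Pi.add_apply, h8, h3, Pi.smul_apply, h1 u (Finset.mem_insert_self _ _), smul_eq_mul]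
  have h9 : (if Γ.frac u = v then ((Q u : ℂ) *
      (Complex.exp (Complex.I * (inner ℝ κ (u : EuclideanSpace ℝ (Fin d)) : ℝ)) * c)) •
        Γ.planeWave u else 0 : Lp ℂ 2 (cellMeasure d)) θ = c * if Γ.frac u = v then (Q u : ℂ) *
        Complex.exp (-(Complex.I * (inner ℝ (Γ.dualVec θ - κ)
          (u : EuclideanSpace ℝ (Fin d)) : ℝ))) else 0 := by
    split_ifs
    · rw [h4, Pi.smul_apply, h1 u (Finset.mem_insert_self _ _), ← phase, smul_eq_mul]; ring
    · simp
  rw [h9]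
  have h10 := Q.fiber_frac_mul_exp (Γ.dualVec θ - κ) v u
  rw [mul_right_comm (Complex.exp _) c, phase, ← mul_assoc, h10, add_mul, mul_comm c, Finset.sum_mul]
  congr 1
  refine Finset.sum_congr rfl fun w hw => ?_
  rw [h2 w (Finset.mem_filter.1 hw).1,
    h1 w (Finset.mem_insert_of_mem (Finset.mem_filter.1 hw).1), ← phase]
  ring

lemma ae_floquetShift_schrodinger (κ : EuclideanSpace ℝ (Fin d)) (φ : Γ.L2) :
    ∀ᵐ θ ∂cellMeasure d, (fun v => Γ.floquetShift κ (Q.schrodinger φ) v θ) =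
      Q.fiber (Γ.dualVec θ - κ) *ᵥ fun w => Γ.floquetShift κ φ w θ := by
  have h1 : ∀ᵐ θ ∂cellMeasure d, ∀ v w, Q.fiberEntryL κ v w (Γ.floquetShift κ φ w) θ =
      Q.fiber (Γ.dualVec θ - κ) v w * Γ.floquetShift κ φ w θ :=
    ae_all_iff.2 fun v => ae_all_iff.2 fun w => Q.coeFn_fiberEntryL κ v w _
  have h2 : ∀ᵐ θ ∂cellMeasure d, ∀ v, (∑ w, Q.fiberEntryL κ v w (Γ.floquetShift κ φ w) :
      Lp ℂ 2 (cellMeasure d)) θ = ∑ w, Q.fiberEntryL κ v w (Γ.floquetShift κ φ w) θ :=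
    ae_all_iff.2 fun v => Lp.coeFn_fun_finsetSum _ _
  filter_upwards [h1, h2] with θ h1 h2
  ext v
  rw [floquetShift_schrodinger_apply, h2]
  simp [Matrix.mulVec, dotProduct, h1]

lemma ae_floquetShift_schrodinger_pow (κ : EuclideanSpace ℝ (Fin d)) (φ : Γ.L2) (n : ℕ) :
    ∀ᵐ θ ∂cellMeasure d, (fun v => Γ.floquetShift κ ((Q.schrodinger ^ n) φ) v θ) =
      (Q.fiber (Γ.dualVec θ - κ)) ^ n *ᵥ fun w => Γ.floquetShift κ φ w θ := by
  induction n with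
  | zero => simp
  | succ n ih =>
    filter_upwards [ih, Q.ae_floquetShift_schrodinger κ ((Q.schrodinger ^ n) φ)] with θ h1 h2
    rw [pow_succ', mul_apply_eq_comp, h2, h1, Matrix.mulVec_mulVec, pow_succ']

end PeriodicPotential
end PeriodicGraph

/-! ### Functional calculus and the semiclassical limit in the fibers -/

namespace PeriodicGraph
namespace PeriodicPotential
namespace Eigenprojections

variable {d : ℕ} {Γ : PeriodicGraph d} {Q : Γ.PeriodicPotential} (P : Q.Eigenprojections)

/-- The functions `∑ fₙ P_n(θ_b)` of the fiber operator. -/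
noncomputable def funCalc (f : Fin Γ.cellCard → ℂ) (θ : Fin d → ℝ) : Matrix Γ.Cell Γ.Cell ℂ :=
  ∑ n, f n • P.proj n θ

lemma proj_mul_proj (m n : Fin Γ.cellCard) (θ : Fin d → ℝ) :
    P.proj m θ * P.proj n θ = if m = n then P.proj n θ else 0 := by
  split_ifs with h
  · rw [h, P.idempotent]
  · exact P.orthogonal m n θ h

lemma proj_mul_funCalc (f : Fin Γ.cellCard → ℂ) (n : Fin Γ.cellCard) (θ : Fin d → ℝ) :
    P.proj n θ * P.funCalc f θ = f n • P.proj n θ := by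
  simp [funCalc, Finset.mul_sum, proj_mul_proj]

lemma funCalc_mul_proj (f : Fin Γ.cellCard → ℂ) (n : Fin Γ.cellCard) (θ : Fin d → ℝ) :
    P.funCalc f θ * P.proj n θ = f n • P.proj n θ := by
  simp [funCalc, Finset.sum_mul, proj_mul_proj]

lemma funCalc_mul (f g : Fin Γ.cellCard → ℂ) (θ : Fin d → ℝ) :
    P.funCalc f θ * P.funCalc g θ = P.funCalc (fun n => f n * g n) θ := by
  conv_lhs => rw [funCalc, Finset.sum_mul]
  simp only [smul_mul_assoc, proj_mul_funCalc, smul_smul]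
  rfl

lemma funCalc_one (θ : Fin d → ℝ) : P.funCalc (fun _ => 1) θ = 1 := by
  simp [funCalc, P.sum_eq_one]

lemma funCalc_conjTranspose (f : Fin Γ.cellCard → ℂ) (θ : Fin d → ℝ) :
    (P.funCalc f θ)ᴴ = P.funCalc (fun n => star (f n)) θ := by
  simp [funCalc, Matrix.conjTranspose_sum, (P.isHermitian _ θ).eq]

lemma fiber_eq_funCalc (θ : Fin d → ℝ) :
    Q.fiber (Γ.dualVec θ) = P.funCalc (fun n => Q.bandFunction n θ) θ :=
  P.spectral_decomposition θ

lemma fiber_pow_eq_funCalc (θ : Fin d → ℝ) (k : ℕ) :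
    Q.fiber (Γ.dualVec θ) ^ k = P.funCalc (fun n => (Q.bandFunction n θ : ℂ) ^ k) θ := by
  induction k with
  | zero => simp [funCalc_one]
  | succ k ih =>
    rw [pow_succ, ih, fiber_eq_funCalc P, funCalc_mul]
    simp only [pow_succ]

/-- The unitary group `e^{-itH(θ_b)}` of the fiber operator. -/
noncomputable def propagator (t : ℝ) (θ : Fin d → ℝ) : Matrix Γ.Cell Γ.Cell ℂ :=
  P.funCalc (fun n => Complex.exp (-(Complex.I * (t : ℂ)) * Q.bandFunction n θ)) θ

lemma propagator_conjTranspose_mul_self (t : ℝ) (θ : Fin d → ℝ) :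
    (P.propagator t θ)ᴴ * P.propagator t θ = 1 := by
  rw [propagator, funCalc_conjTranspose, funCalc_mul, ← P.funCalc_one θ]
  congr 1
  ext n
  rw [Complex.star_def, ← Complex.exp_conj, ← Complex.exp_add]
  simp

lemma inner_mulVec_mulVec (A B : Matrix Γ.Cell Γ.Cell ℂ) (x y : Γ.Cell → ℂ) :
    inner ℂ (WithLp.toLp 2 (A *ᵥ x)) (WithLp.toLp 2 (B *ᵥ y)) =
      inner ℂ (WithLp.toLp 2 x) (WithLp.toLp 2 ((Aᴴ * B) *ᵥ y)) := by
  rw [EuclideanSpace.inner_toLp_toLp, EuclideanSpace.inner_toLp_toLp, dotProduct_comm,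
    dotProduct_comm _ (star x), Matrix.star_mulVec, ← Matrix.dotProduct_mulVec,
    Matrix.mulVec_mulVec]

lemma norm_propagator_mulVec (t : ℝ) (θ : Fin d → ℝ) (x : Γ.Cell → ℂ) :
    ‖WithLp.toLp 2 (P.propagator t θ *ᵥ x)‖ = ‖WithLp.toLp 2 x‖ := by
  rw [@norm_eq_sqrt_re_inner ℂ, @norm_eq_sqrt_re_inner ℂ, inner_mulVec_mulVec,
    propagator_conjTranspose_mul_self, Matrix.one_mulVec]

lemma inner_funCalc_mulVec (f : Fin Γ.cellCard → ℂ) (θ : Fin d → ℝ) (x : Γ.Cell → ℂ) :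
    inner ℂ (WithLp.toLp 2 x) (WithLp.toLp 2 (P.funCalc f θ *ᵥ x)) =
      ∑ n, f n * (‖WithLp.toLp 2 (P.proj n θ *ᵥ x)‖ ^ 2 : ℝ) := by
  simp only [funCalc, Matrix.sum_mulVec, WithLp.toLp_sum, inner_sum, Matrix.smul_mulVec,
    WithLp.toLp_smul, inner_smul_right]
  refine Finset.sum_congr rfl fun n _ => ?_
  have h := inner_mulVec_mulVec (P.proj n θ) (P.proj n θ) x x
  rw [(P.isHermitian n θ).eq, P.idempotent, inner_self_eq_norm_sq_to_K] at h
  rw [← h]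
  push_cast
  rfl

lemma sum_norm_proj_mulVec (θ : Fin d → ℝ) (x : Γ.Cell → ℂ) :
    ∑ n, ‖WithLp.toLp 2 (P.proj n θ *ᵥ x)‖ ^ 2 = ‖WithLp.toLp 2 x‖ ^ 2 := by
  have h := P.inner_funCalc_mulVec (fun _ => 1) θ x
  rw [funCalc_one, Matrix.one_mulVec, inner_self_eq_norm_sq_to_K] at h
  simp only [one_mul] at h
  rw [← Complex.ofReal_inj]
  push_cast at h ⊢
  exact h.symm

end Eigenprojections

variable {d : ℕ} {Γ : PeriodicGraph d} {Q : Γ.PeriodicPotential}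

/-- Where two differentiable bands touch, their derivatives coincide. -/
lemma fderiv_bandFunction_eq {θ : Fin d → ℝ}
    (h : ∀ n, DifferentiableAt ℝ (Q.bandFunction n) θ) {m n : Fin Γ.cellCard}
    (hmn : Q.bandFunction m θ = Q.bandFunction n θ) :
    fderiv ℝ (Q.bandFunction m) θ = fderiv ℝ (Q.bandFunction n) θ := by
  wlog hle : m ≤ n generalizing m n
  · exact (this hmn.symm (le_of_not_ge hle)).symm
  -- The bands are ordered everywhere, so their difference is nonnegative and has a minimum where
  -- they touch.
  have hmin : IsLocalMin (Q.bandFunction n - Q.bandFunction m) θ :=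
    Eventually.of_forall fun θ' => by
      simpa [hmn] using Q.bandFunction_monotone θ' hle
  have := hmin.fderiv_eq_zero
  rw [fderiv_sub (h n) (h m), sub_eq_zero] at this
  exact this.symm

/-- As `E_n(θ) = E_m(θ)`, the factor `t (E_n(θ) - E_m(θ - η/t))` is minus the difference quotient of
`E_m` in direction `-η` with step `1/t`. It tends to `∂_η E_m(θ)`, which equals `∂_η E_n(θ)` by
`fderiv_bandFunction_eq`. -/
lemma tendsto_phase {θ η : Fin d → ℝ}
    (h : ∀ n, DifferentiableAt ℝ (Q.bandFunction n) θ) {m n : Fin Γ.cellCard}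
    (hmn : Q.bandFunction n θ = Q.bandFunction m θ) :
    Tendsto (fun t : ℝ => Complex.exp (Complex.I * (t : ℂ) *
      (Q.bandFunction n θ - Q.bandFunction m (θ - t⁻¹ • η)))) atTop
      (nhds (Complex.exp (Complex.I * (fderiv ℝ (Q.bandFunction n) θ η : ℝ)))) := by
  have h1 := ((h m).hasFDerivAt.hasLineDerivAt (-η)).tendsto_slope_zero_right.comp
    tendsto_inv_atTop_nhdsGT_zero
  have h2 : Tendsto (fun t : ℝ => t * (Q.bandFunction n θ - Q.bandFunction m (θ - t⁻¹ • η))) atTop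
      (nhds (fderiv ℝ (Q.bandFunction n) θ η)) := by
    rw [fderiv_bandFunction_eq h hmn]
    refine (h1.neg.congr fun t => ?_).trans_eq (by simp)
    simp only [Function.comp_apply, inv_inv, smul_neg, smul_eq_mul, ← sub_eq_add_neg, hmn]
    ring
  have hc : Continuous fun x : ℝ => Complex.exp (Complex.I * (x : ℂ)) := by fun_prop
  refine ((hc.tendsto _).comp h2).congr fun t => ?_
  simp only [Function.comp_apply]
  push_cast
  ring_nf

lemma tendsto_sub_inv_smul (θ η : Fin d → ℝ) :
    Tendsto (fun t : ℝ => θ - t⁻¹ • η) atTop (nhds θ) := by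
  simpa using tendsto_const_nhds.sub ((tendsto_inv_atTop_zero (𝕜 := ℝ)).smul_const η)

namespace Eigenprojections

variable (P : Q.Eigenprojections)

open scoped Matrix.Norms.L2Operator

lemma norm_proj_le (n : Fin Γ.cellCard) (θ : Fin d → ℝ) : ‖P.proj n θ‖ ≤ 1 :=
  IsStarProjection.norm_le _ ⟨P.idempotent n θ, P.isHermitian n θ⟩

lemma norm_proj_mul_proj_le (m n : Fin Γ.cellCard) (θ θ' : Fin d → ℝ) :
    ‖P.proj n θ * P.proj m θ'‖ ≤ 1 :=
  (norm_mul_le _ _).trans (mul_le_one₀ (P.norm_proj_le n θ) (norm_nonneg _) (P.norm_proj_le m θ'))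

/-- Sandwiching `H(θ_b) - H(θ'_b)` between `P_n(θ)` and `P_m(θ')` gives `(E_n(θ) - E_m(θ')) P_n(θ)
P_m(θ')`. As `θ' → θ` the difference of fibers vanishes while the gap does not. The projections
themselves need not be continuous. -/
lemma tendsto_proj_mul_proj {θ : Fin d → ℝ} (η : Fin d → ℝ) {m n : Fin Γ.cellCard}
    (hmn : Q.bandFunction n θ ≠ Q.bandFunction m θ) :
    Tendsto (fun t : ℝ => P.proj n θ * P.proj m (θ - t⁻¹ • η)) atTop (nhds 0) := by
  have key : ∀ θ', ((Q.bandFunction n θ - Q.bandFunction m θ' : ℝ) : ℂ) •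
      (P.proj n θ * P.proj m θ') =
      P.proj n θ * (Q.fiber (Γ.dualVec θ) - Q.fiber (Γ.dualVec θ')) * P.proj m θ' := by
    intro θ'
    rw [mul_sub, sub_mul, P.fiber_eq_funCalc, P.fiber_eq_funCalc, proj_mul_funCalc, mul_assoc,
      funCalc_mul_proj, Complex.ofReal_sub, sub_smul, smul_mul_assoc, mul_smul_comm]
  have hθ := tendsto_sub_inv_smul θ η
  have hfib : Continuous fun θ => Q.fiber (Γ.dualVec θ) :=
    continuous_pi fun v => continuous_pi fun w => (Q.continuous_fiber v w).comp Γ.continuous_dualVec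
  have h1 : Tendsto (fun t : ℝ => ‖Q.fiber (Γ.dualVec θ) - Q.fiber (Γ.dualVec (θ - t⁻¹ • η))‖) atTop
      (nhds 0) := by
    have := (tendsto_const_nhds (x := Q.fiber (Γ.dualVec θ))).sub ((hfib.tendsto θ).comp hθ)
    simpa using this.norm
  have h2 : Tendsto (fun t : ℝ => ‖((Q.bandFunction n θ -
      Q.bandFunction m (θ - t⁻¹ • η) : ℝ) : ℂ)⁻¹‖) atTop
      (nhds ‖((Q.bandFunction n θ - Q.bandFunction m θ : ℝ) : ℂ)⁻¹‖) := by
    have h3 : Tendsto (fun t : ℝ => Q.bandFunction n θ - Q.bandFunction m (θ - t⁻¹ • η)) atTop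
        (nhds (Q.bandFunction n θ - Q.bandFunction m θ)) :=
      tendsto_const_nhds.sub (((Q.continuous_bandFunction m).tendsto θ).comp hθ)
    refine (((Complex.continuous_ofReal.tendsto _).comp h3).inv₀ ?_).norm
    rw [Complex.ofReal_ne_zero]
    exact sub_ne_zero.2 hmn
  have hne : ∀ᶠ t : ℝ in atTop, Q.bandFunction n θ - Q.bandFunction m (θ - t⁻¹ • η) ≠ 0 := by
    have h3 : Tendsto (fun t : ℝ => Q.bandFunction n θ - Q.bandFunction m (θ - t⁻¹ • η)) atTop
        (nhds (Q.bandFunction n θ - Q.bandFunction m θ)) :=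
      tendsto_const_nhds.sub (((Q.continuous_bandFunction m).tendsto θ).comp hθ)
    exact h3.eventually_ne (sub_ne_zero.2 hmn)
  refine squeeze_zero_norm' ?_ ((h2.mul h1).trans_eq (by simp))
  filter_upwards [hne] with t ht
  have : P.proj n θ * P.proj m (θ - t⁻¹ • η) =
      ((Q.bandFunction n θ - Q.bandFunction m (θ - t⁻¹ • η) : ℝ) : ℂ)⁻¹ •
      (P.proj n θ * (Q.fiber (Γ.dualVec θ) - Q.fiber (Γ.dualVec (θ - t⁻¹ • η))) *
        P.proj m (θ - t⁻¹ • η)) := by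
    rw [← key, inv_smul_smul₀ (Complex.ofReal_ne_zero.2 ht)]
  rw [this, norm_smul]
  gcongr
  refine (norm_mul_le _ _).trans ?_
  refine (mul_le_of_le_one_right (norm_nonneg _) (P.norm_proj_le _ _)).trans ?_
  exact (norm_mul_le _ _).trans (mul_le_of_le_one_left (norm_nonneg _) (P.norm_proj_le _ _))

/-- The semiclassical limit of the fiber propagators. -/
theorem tendsto_propagator {θ : Fin d → ℝ} (h : ∀ n, DifferentiableAt ℝ (Q.bandFunction n) θ)
    (η : Fin d → ℝ) :
    Tendsto (fun t : ℝ => (P.propagator t θ)ᴴ * P.propagator t (θ - t⁻¹ • η)) atTop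
      (nhds (P.funCalc
        (fun n => Complex.exp (Complex.I * (fderiv ℝ (Q.bandFunction n) θ η : ℝ))) θ)) := by
  set g := fun n => Complex.exp (Complex.I * (fderiv ℝ (Q.bandFunction n) θ η : ℝ)) with hg
  -- Inserting `∑ P_m(θ - η/t) = 1` writes the limit as a double sum over the same products of
  -- projections, so only differences of coefficients remain.
  have e1 : ∀ t : ℝ, (P.propagator t θ)ᴴ * P.propagator t (θ - t⁻¹ • η) =
      P.funCalc g θ + ∑ n, ∑ m, (Complex.exp (Complex.I * (t : ℂ) *
        (Q.bandFunction n θ - Q.bandFunction m (θ - t⁻¹ • η))) - g n) •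
        (P.proj n θ * P.proj m (θ - t⁻¹ • η)) := by
    intro t
    have e2 : P.funCalc g θ = ∑ n, ∑ m, g n • (P.proj n θ * P.proj m (θ - t⁻¹ • η)) := by
      simp only [← Finset.smul_sum, ← Finset.mul_sum, P.sum_eq_one, mul_one, funCalc]
    rw [e2, ← Finset.sum_add_distrib]
    simp only [← Finset.sum_add_distrib, ← add_smul, add_sub_cancel]
    rw [propagator, funCalc_conjTranspose, propagator, funCalc, funCalc, Finset.sum_mul_sum]
    refine Finset.sum_congr rfl fun n _ => Finset.sum_congr rfl fun m _ => ?_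
    rw [smul_mul_smul_comm, Complex.star_def, ← Complex.exp_conj, ← Complex.exp_add]
    congr 2
    simp
    ring
  simp only [e1]
  suffices hterm : ∀ n m, Tendsto (fun t : ℝ => (Complex.exp (Complex.I * (t : ℂ) *
      (Q.bandFunction n θ - Q.bandFunction m (θ - t⁻¹ • η))) - g n) •
      (P.proj n θ * P.proj m (θ - t⁻¹ • η))) atTop (nhds 0) by
    simpa using (tendsto_const_nhds (x := P.funCalc g θ)).add
      (tendsto_finsetSum Finset.univ fun n _ => tendsto_finsetSum Finset.univ fun m _ => hterm n m)
  intro n m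
  -- For equal eigenvalues the coefficient tends to zero and the product of projections is bounded
  -- by `1`; otherwise the coefficient, a difference of two phases, is bounded by `2` and the
  -- product tends to zero.
  by_cases hmn : Q.bandFunction n θ = Q.bandFunction m θ
  · have h1 : Tendsto (fun t : ℝ => ‖Complex.exp (Complex.I * (t : ℂ) *
        (Q.bandFunction n θ - Q.bandFunction m (θ - t⁻¹ • η))) - g n‖) atTop (nhds 0) := by
      simpa [hg] using ((tendsto_phase h hmn (η := η)).sub_const (g n)).norm
    refine squeeze_zero_norm (fun t => ?_) h1
    rw [norm_smul]
    exact mul_le_of_le_one_right (norm_nonneg _) (P.norm_proj_mul_proj_le _ _ _ _)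
  · have h1 : Tendsto (fun t : ℝ => 2 * ‖P.proj n θ * P.proj m (θ - t⁻¹ • η)‖) atTop (nhds 0) := by
      simpa using ((P.tendsto_proj_mul_proj η hmn).norm).const_mul 2
    refine squeeze_zero_norm (fun t => ?_) h1
    rw [norm_smul]
    gcongr
    refine (norm_sub_le _ _).trans ?_
    rw [mul_assoc, ← Complex.ofReal_sub, ← Complex.ofReal_mul, hg]
    simp only [mul_comm Complex.I, Complex.norm_exp_ofReal_mul_I]
    norm_num

lemma tendsto_inner_propagator {θ : Fin d → ℝ}
    (h : ∀ n, DifferentiableAt ℝ (Q.bandFunction n) θ) (η : Fin d → ℝ) (x : Γ.Cell → ℂ) :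
    Tendsto (fun t : ℝ => inner ℂ (WithLp.toLp 2 (P.propagator t θ *ᵥ x))
      (WithLp.toLp 2 (P.propagator t (θ - t⁻¹ • η) *ᵥ x))) atTop
      (nhds (∑ n, Complex.exp (Complex.I * (fderiv ℝ (Q.bandFunction n) θ η : ℝ)) *
        (‖WithLp.toLp 2 (P.proj n θ *ᵥ x)‖ ^ 2 : ℝ))) := by
  rw [← P.inner_funCalc_mulVec]
  simp only [inner_mulVec_mulVec]
  have hc : Continuous fun A : Matrix Γ.Cell Γ.Cell ℂ =>
      inner ℂ (WithLp.toLp 2 x) (WithLp.toLp 2 (A *ᵥ x)) := by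
    simp only [EuclideanSpace.inner_toLp_toLp]
    fun_prop
  exact (hc.tendsto _).comp (P.tendsto_propagator h η)

end Eigenprojections
end PeriodicPotential
end PeriodicGraph

/-! ### The evolution on the graph and its modulated matrix elements -/

namespace PeriodicGraph

variable {d : ℕ} {Γ : PeriodicGraph d}

lemma inner_floquetSpace (F G : Γ.FloquetSpace) : inner ℂ F G =
    ∫ θ, inner ℂ (WithLp.toLp 2 fun v => F v θ : EuclideanSpace ℂ Γ.Cell)
      (WithLp.toLp 2 fun v => G v θ : EuclideanSpace ℂ Γ.Cell) ∂cellMeasure d := by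
  simp only [PiLp.inner_apply, L2.inner_def]
  rw [integral_finsetSum _ fun v _ => L2.integrable_inner (F v) (G v)]

lemma integrable_inner_floquetSpace (F G : Γ.FloquetSpace) :
    Integrable (fun θ => inner ℂ (WithLp.toLp 2 fun v => F v θ : EuclideanSpace ℂ Γ.Cell)
      (WithLp.toLp 2 fun v => G v θ : EuclideanSpace ℂ Γ.Cell)) (cellMeasure d) := by
  simp only [PiLp.inner_apply]
  exact integrable_finsetSum _ fun v _ => L2.integrable_inner (F v) (G v)

lemma integrable_norm_sq_floquetSpace (F : Γ.FloquetSpace) :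
    Integrable (fun θ => ‖(WithLp.toLp 2 fun v => F v θ : EuclideanSpace ℂ Γ.Cell)‖ ^ 2)
      (cellMeasure d) := by
  refine (integrable_inner_floquetSpace F F).re.congr (Eventually.of_forall fun θ => ?_)
  exact inner_self_eq_norm_sq (𝕜 := ℂ) _

lemma norm_sq_floquetSpace (F : Γ.FloquetSpace) : ‖F‖ ^ 2 =
    ∫ θ, ‖(WithLp.toLp 2 fun v => F v θ : EuclideanSpace ℂ Γ.Cell)‖ ^ 2 ∂cellMeasure d := by
  rw [← inner_self_eq_norm_sq (𝕜 := ℂ) F, inner_floquetSpace]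
  refine (integral_re (integrable_inner_floquetSpace F F)).symm.trans ?_
  exact integral_congr_ae (Eventually.of_forall fun θ => inner_self_eq_norm_sq (𝕜 := ℂ) _)

lemma modulate_modulate_neg (κ : EuclideanSpace ℝ (Fin d)) (f : Γ.L2) :
    Γ.modulate κ (Γ.modulate (-κ) f) = f := by
  ext v
  rw [modulate_apply, modulate_apply, ← mul_assoc, ← Complex.exp_add]
  simp

/-- Dominated convergence in the sum over vertices, with bound `(2|f(v)|)²`. -/
lemma tendsto_modulate (f : Γ.L2) :
    Tendsto (fun κ => Γ.modulate κ f) (nhds 0) (nhds f) := by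
  rw [tendsto_iff_norm_sub_tendsto_zero]
  have hf : Summable fun v => ‖f v‖ ^ 2 := (Γ.memLp_two_iff f).1 (lp.memℓp f)
  have hsq : Tendsto (fun κ => ‖Γ.modulate κ f - f‖ ^ 2) (nhds 0) (nhds 0) := by
    have e : ∀ κ, ‖Γ.modulate κ f - f‖ ^ 2 = ∑' v, ‖Γ.modulate κ f v - f v‖ ^ 2 := fun κ => by
      have := lp.norm_rpow_eq_tsum (p := 2) (by simp) (Γ.modulate κ f - f)
      simpa using this
    simp only [e]
    have := tendsto_tsum_of_dominated_convergence (𝓕 := nhds (0 : EuclideanSpace ℝ (Fin d)))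
      (f := fun κ v => ‖Γ.modulate κ f v - f v‖ ^ 2) (g := fun _ => (0 : ℝ))
      (hf.mul_left (2 ^ 2)) (fun v => ?_) (Eventually.of_forall fun κ v => ?_)
    · simpa using this
    · have hc : Continuous fun κ => ‖Γ.modulate κ f v - f v‖ ^ 2 := by
        simp only [modulate_apply]
        fun_prop
      simpa [modulate_zero] using hc.tendsto 0
    · rw [Real.norm_of_nonneg (sq_nonneg _), ← mul_pow]
      gcongr
      refine (norm_sub_le _ _).trans ?_
      rw [modulate_apply, norm_mul, mul_comm Complex.I, Complex.norm_exp_ofReal_mul_I]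
      linarith
  simpa using hsq.sqrt

namespace PeriodicPotential

variable {Q : Γ.PeriodicPotential}

lemma hasSum_evolution (t : ℝ) (φ : Γ.L2) :
    HasSum (fun n : ℕ => ((n.factorial⁻¹ : ℂ) * (-(Complex.I * (t : ℂ))) ^ n) • (Q.schrodinger ^ n) φ)
      (Q.evolution t φ) := by
  have h := NormedSpace.exp_series_hasSum_exp' (𝕂 := ℂ) ((-(Complex.I * (t : ℂ))) • Q.schrodinger)
  have h2 := h.mapL (ContinuousLinearMap.apply ℂ Γ.L2 φ)
  simp only [smul_pow, map_smul, ContinuousLinearMap.apply_apply, smul_smul] at h2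
  exact h2

namespace Eigenprojections

variable (P : Q.Eigenprojections)

lemma hasSum_funCalc_mulVec {f : ℕ → Fin Γ.cellCard → ℂ} {g : Fin Γ.cellCard → ℂ}
    (h : ∀ n, HasSum (fun k => f k n) (g n)) (θ : Fin d → ℝ) (x : Γ.Cell → ℂ) (v : Γ.Cell) :
    HasSum (fun k => (P.funCalc (f k) θ *ᵥ x) v) ((P.funCalc g θ *ᵥ x) v) := by
  simp only [funCalc, Matrix.sum_mulVec, Matrix.smul_mulVec, Finset.sum_apply, Pi.smul_apply,
    smul_eq_mul]
  exact hasSum_sum fun n _ => (h n).mul_right _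

/-- The exponential series converges in `ℓ²`, hence its transform in `L²`. The intertwining relation
for powers makes the transformed partial sums converge pointwise almost everywhere to the fiber
propagator, and the two limits agree. The point `θ - η` may leave the unit cell; bands and
projections are given for all `θ`. -/
lemma ae_floquetShift_evolution (t : ℝ) (η : Fin d → ℝ) (φ : Γ.L2) :
    ∀ᵐ θ ∂cellMeasure d, (fun v => Γ.floquetShift (Γ.dualVec η) (Q.evolution t φ) v θ) =
      P.propagator t (θ - η) *ᵥ fun w => Γ.floquetShift (Γ.dualVec η) φ w θ := by
  set κ := Γ.dualVec η
  set c : ℕ → ℂ := fun n => (n.factorial⁻¹ : ℂ) * (-(Complex.I * (t : ℂ))) ^ n with hc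
  suffices h : ∀ v, ∀ᵐ θ ∂cellMeasure d, Γ.floquetShift κ (Q.evolution t φ) v θ =
      (P.propagator t (θ - η) *ᵥ fun w => Γ.floquetShift κ φ w θ) v by
    filter_upwards [ae_all_iff.2 h] with θ hθ
    exact funext hθ
  intro v
  let pr := PiLp.proj (𝕜 := ℂ) 2 (fun _ : Γ.Cell => Lp ℂ 2 (cellMeasure d)) v
  have h1 := ((hasSum_evolution (Q := Q) t φ).mapL
    (pr.comp (Γ.floquetShift κ).toContinuousLinearMap)).tendsto_sum_nat
  refine Lp.ae_eq_of_tendsto h1 ?_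
  have h2 : ∀ᵐ θ ∂cellMeasure d, ∀ k, (fun v => Γ.floquetShift κ ((Q.schrodinger ^ k) φ) v θ) =
      (Q.fiber (Γ.dualVec θ - κ)) ^ k *ᵥ fun w => Γ.floquetShift κ φ w θ :=
    ae_all_iff.2 fun k => Q.ae_floquetShift_schrodinger_pow κ φ k
  have h3 : ∀ᵐ θ ∂cellMeasure d, ∀ N, (∑ k ∈ Finset.range N,
      c k • Γ.floquetShift κ ((Q.schrodinger ^ k) φ) v : Lp ℂ 2 (cellMeasure d)) θ =
      ∑ k ∈ Finset.range N, (c k • Γ.floquetShift κ ((Q.schrodinger ^ k) φ) v :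
        Lp ℂ 2 (cellMeasure d)) θ :=
    ae_all_iff.2 fun N => Lp.coeFn_fun_finsetSum _ _
  have h4 : ∀ᵐ θ ∂cellMeasure d, ∀ k, (c k • Γ.floquetShift κ ((Q.schrodinger ^ k) φ) v :
      Lp ℂ 2 (cellMeasure d)) θ = c k * Γ.floquetShift κ ((Q.schrodinger ^ k) φ) v θ :=
    ae_all_iff.2 fun k => Lp.coeFn_smul _ _
  filter_upwards [h2, h3, h4] with θ h2 h3 h4
  have h5 : ∀ n, HasSum (fun k => c k * (Q.bandFunction n (θ - η) : ℂ) ^ k)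
      (Complex.exp (-(Complex.I * (t : ℂ)) * Q.bandFunction n (θ - η))) := by
    intro n
    have := NormedSpace.exp_series_hasSum_exp' (𝕂 := ℂ)
      (-(Complex.I * (t : ℂ)) * (Q.bandFunction n (θ - η) : ℂ))
    rw [← Complex.exp_eq_exp_ℂ] at this
    refine this.congr_fun fun k => ?_
    simp only [hc, mul_pow, smul_eq_mul, mul_assoc]
  have h6 := (P.hasSum_funCalc_mulVec h5 (θ - η) (fun w => Γ.floquetShift κ φ w θ) v).tendsto_sum_nat
  refine h6.congr fun N => ?_
  simp only [ContinuousLinearMap.comp_apply, map_smul, pr, PiLp.proj_apply,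
    LinearIsometry.coe_toContinuousLinearMap]
  refine Eq.trans ?_ (h3 N).symm
  refine Finset.sum_congr rfl fun k _ => ?_
  rw [h4 k, congrFun (h2 k) v, ← dualVec_sub, P.fiber_pow_eq_funCalc]
  have : P.funCalc (fun n => c k * (Q.bandFunction n (θ - η) : ℂ) ^ k) (θ - η) =
      c k • P.funCalc (fun n => (Q.bandFunction n (θ - η) : ℂ) ^ k) (θ - η) := by
    simp only [funCalc, Finset.smul_sum, smul_smul]
  rw [this, Matrix.smul_mulVec, Pi.smul_apply, smul_eq_mul]

lemma ae_floquetIso_evolution (t : ℝ) (φ : Γ.L2) :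
    ∀ᵐ θ ∂cellMeasure d, (fun v => Γ.floquetIso (Q.evolution t φ) v θ) =
      P.propagator t θ *ᵥ fun w => Γ.floquetIso φ w θ := by
  simpa [dualVec_zero, floquetShift_zero] using P.ae_floquetShift_evolution t 0 φ

end Eigenprojections

/-- Read off from the unitarity of the fiber propagators through the Floquet isometry. -/
lemma norm_evolution (t : ℝ) (φ : Γ.L2) : ‖Q.evolution t φ‖ = ‖φ‖ := by
  obtain ⟨P⟩ := Q.nonempty_eigenprojections
  rw [← Γ.floquetIso.norm_map, ← Γ.floquetIso.norm_map φ,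
    ← sq_eq_sq₀ (norm_nonneg _) (norm_nonneg _), norm_sq_floquetSpace, norm_sq_floquetSpace]
  refine integral_congr_ae ?_
  filter_upwards [P.ae_floquetIso_evolution t φ] with θ h
  rw [h, P.norm_propagator_mulVec]

namespace Eigenprojections

variable (P : Q.Eigenprojections)

/-- The inner modulation cancels the one in `floquetShift`, so both slots contain the same vector `x
θ` and only the propagators differ. The fiber limit applies almost everywhere, with `‖x θ‖²` as
integrable bound by unitarity. -/
lemma tendsto_integral_propagator (ψ : Γ.L2) (η : Fin d → ℝ) :
    Tendsto (fun t : ℝ => inner ℂ (Q.evolution t ψ) (Γ.modulate (Γ.dualVec (t⁻¹ • η))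
      (Q.evolution t (Γ.modulate (-Γ.dualVec (t⁻¹ • η)) ψ)))) atTop
      (nhds (∫ θ, ∑ n, Complex.exp (Complex.I * (fderiv ℝ (Q.bandFunction n) θ η : ℝ)) *
        (‖(WithLp.toLp 2 (P.proj n θ *ᵥ fun v => Γ.floquetIso ψ v θ) :
          EuclideanSpace ℂ Γ.Cell)‖ ^ 2 : ℝ) ∂cellMeasure d)) := by
  set x : (Fin d → ℝ) → Γ.Cell → ℂ := fun θ v => Γ.floquetIso ψ v θ with hx
  have e : ∀ t : ℝ, (fun θ => inner ℂ
      (WithLp.toLp 2 fun v => Γ.floquetIso (Q.evolution t ψ) v θ : EuclideanSpace ℂ Γ.Cell)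
      (WithLp.toLp 2 fun v => Γ.floquetShift (Γ.dualVec (t⁻¹ • η))
        (Q.evolution t (Γ.modulate (-Γ.dualVec (t⁻¹ • η)) ψ)) v θ :
          EuclideanSpace ℂ Γ.Cell)) =ᵐ[cellMeasure d] fun θ =>
      inner ℂ (WithLp.toLp 2 (P.propagator t θ *ᵥ x θ))
        (WithLp.toLp 2 (P.propagator t (θ - t⁻¹ • η) *ᵥ x θ)) := by
    intro t
    filter_upwards [P.ae_floquetIso_evolution t ψ, P.ae_floquetShift_evolution t (t⁻¹ • η)
      (Γ.modulate (-Γ.dualVec (t⁻¹ • η)) ψ)] with θ h1 h2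
    have h3 : Γ.floquetShift (Γ.dualVec (t⁻¹ • η)) (Γ.modulate (-Γ.dualVec (t⁻¹ • η)) ψ) =
        Γ.floquetIso ψ := congrArg Γ.floquetIso (modulate_modulate_neg _ _)
    rw [h1, h2, h3]
  have e' : ∀ t : ℝ, inner ℂ (Q.evolution t ψ) (Γ.modulate (Γ.dualVec (t⁻¹ • η))
      (Q.evolution t (Γ.modulate (-Γ.dualVec (t⁻¹ • η)) ψ))) = ∫ θ,
      inner ℂ (WithLp.toLp 2 (P.propagator t θ *ᵥ x θ))
        (WithLp.toLp 2 (P.propagator t (θ - t⁻¹ • η) *ᵥ x θ)) ∂cellMeasure d := by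
    intro t
    rw [← inner_floquetShift, inner_floquetSpace]
    exact integral_congr_ae (e t)
  simp only [e']
  refine tendsto_integral_filter_of_dominated_convergence
    (fun θ => ‖(WithLp.toLp 2 (x θ) : EuclideanSpace ℂ Γ.Cell)‖ ^ 2)
    (Eventually.of_forall fun t => ?_) (Eventually.of_forall fun t => Eventually.of_forall fun θ => ?_)
    (integrable_norm_sq_floquetSpace _) ?_
  · exact (integrable_inner_floquetSpace _ _).aestronglyMeasurable.congr (e t)
  · refine (norm_inner_le_norm _ _).trans_eq ?_
    rw [norm_propagator_mulVec, norm_propagator_mulVec, sq]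
  · filter_upwards [ae_restrict_of_ae Q.ae_differentiableAt_bandFunction] with θ hθ
    exact P.tendsto_inner_propagator hθ η (x θ)

/-- Removing the inner modulation costs at most `‖ψ‖ ‖ψ - M_{-κ}ψ‖` with `κ = η_b/t`, because
evolution and modulation preserve norms, and this tends to zero. -/
lemma tendsto_inner_modulate_evolution (ψ : Γ.L2) (η : Fin d → ℝ) :
    Tendsto (fun t : ℝ => inner ℂ (Q.evolution t ψ)
      (Γ.modulate (Γ.dualVec (t⁻¹ • η)) (Q.evolution t ψ))) atTop
      (nhds (∫ θ, ∑ n, Complex.exp (Complex.I * (fderiv ℝ (Q.bandFunction n) θ η : ℝ)) *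
        (‖(WithLp.toLp 2 (P.proj n θ *ᵥ fun v => Γ.floquetIso ψ v θ) :
          EuclideanSpace ℂ Γ.Cell)‖ ^ 2 : ℝ) ∂cellMeasure d)) := by
  have hκ : Tendsto (fun t : ℝ => -Γ.dualVec (t⁻¹ • η)) atTop (nhds 0) := by
    have := ((tendsto_inv_atTop_zero (𝕜 := ℝ)).smul_const (Γ.dualVec η)).neg
    simpa [dualVec_smul] using this
  have herr : Tendsto (fun t : ℝ => inner ℂ (Q.evolution t ψ) (Γ.modulate (Γ.dualVec (t⁻¹ • η))
      (Q.evolution t (ψ - Γ.modulate (-Γ.dualVec (t⁻¹ • η)) ψ)))) atTop (nhds 0) := by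
    have h1 : Tendsto (fun t : ℝ => ‖ψ‖ * ‖ψ - Γ.modulate (-Γ.dualVec (t⁻¹ • η)) ψ‖) atTop
        (nhds 0) := by
      simpa using (((tendsto_const_nhds (x := ψ)).sub ((tendsto_modulate ψ).comp hκ)).norm).const_mul ‖ψ‖
    refine squeeze_zero_norm (fun t => ?_) h1
    refine (norm_inner_le_norm _ _).trans_eq ?_
    rw [LinearIsometry.norm_map, norm_evolution, norm_evolution]
  refine ((P.tendsto_integral_propagator ψ η).add herr).congr' ?_ |>.trans_eq (by rw [add_zero])
  refine Eventually.of_forall fun t => ?_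
  dsimp only
  rw [← inner_add_right, ← map_add, ← map_add, add_sub_cancel]

/-! ### Total masses and characteristic functions of the two laws -/

lemma measurable_density (ψ : Γ.L2) :
    Measurable fun p : (Fin d → ℝ) × Fin Γ.cellCard =>
      ENNReal.ofReal (∑ v, ‖(P.proj p.2 p.1 *ᵥ fun w => Γ.floquet ψ w p.1) v‖ ^ 2) := by
  refine measurable_from_prod_countable_left fun n => ?_
  have h1 := fun w => (Lp.stronglyMeasurable (Γ.floquet ψ w)).measurable
  have h2 := P.measurable_proj n
  simp only [Matrix.mulVec, dotProduct]
  fun_prop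

lemma density_eq (ψ : Γ.L2) (n : Fin Γ.cellCard) (θ : Fin d → ℝ) :
    ∑ v, ‖(P.proj n θ *ᵥ fun w => Γ.floquet ψ w θ) v‖ ^ 2 =
      ‖(WithLp.toLp 2 (P.proj n θ *ᵥ fun v => Γ.floquetIso ψ v θ) :
          EuclideanSpace ℂ Γ.Cell)‖ ^ 2 := by
  rw [EuclideanSpace.norm_sq_eq]
  simp only [floquetIso_apply]

/-- Pythagoras for the projections in each fiber, then the Floquet isometry, give total mass `‖ψ‖²`.
-/
theorem isProbabilityMeasure_bandMeasure {ψ : Γ.L2} (hψ : ‖ψ‖ = 1) :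
    IsProbabilityMeasure (P.bandMeasure ψ) := by
  constructor
  rw [bandMeasure, withDensity_apply _ MeasurableSet.univ, Measure.restrict_univ,
    lintegral_prod _ (P.measurable_density ψ).aemeasurable]
  simp only [lintegral_count, tsum_fintype, density_eq]
  simp only [← ENNReal.ofReal_sum_of_nonneg fun (n : Fin Γ.cellCard) _ => sq_nonneg _,
    sum_norm_proj_mulVec]
  rw [← ofReal_integral_eq_lintegral_ofReal (integrable_norm_sq_floquetSpace _)
    (Eventually.of_forall fun θ => sq_nonneg _), ← norm_sq_floquetSpace, LinearIsometry.norm_map, hψ]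
  simp

theorem isProbabilityMeasure_limitLaw {ψ : Γ.L2} (hψ : ‖ψ‖ = 1) :
    IsProbabilityMeasure (P.limitLaw ψ) :=
  have := P.isProbabilityMeasure_bandMeasure hψ
  Measure.isProbabilityMeasure_map Q.measurable_velocity.aemeasurable

lemma charFun_limitLaw {ψ : Γ.L2} (hψ : ‖ψ‖ = 1) (ξ : EuclideanSpace ℝ (Fin d)) :
    charFun (P.limitLaw ψ) ξ =
      ∫ θ, ∑ n, Complex.exp (Complex.I * (fderiv ℝ (Q.bandFunction n) θ (Γ.dualCoord ξ) : ℝ)) *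
        (‖(WithLp.toLp 2 (P.proj n θ *ᵥ fun v => Γ.floquetIso ψ v θ) :
          EuclideanSpace ℂ Γ.Cell)‖ ^ 2 : ℝ) ∂cellMeasure d := by
  have := P.isProbabilityMeasure_bandMeasure hψ
  have hm : Measurable fun p => Complex.exp ((inner ℝ (Q.velocity p) ξ : ℝ) * Complex.I) := by
    have := Q.measurable_velocity
    fun_prop
  have hi : Integrable (fun p => Complex.exp ((inner ℝ (Q.velocity p) ξ : ℝ) * Complex.I))
      (P.bandMeasure ψ) :=
    Integrable.of_bound hm.aestronglyMeasurable 1 (Eventually.of_forall fun p => by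
      rw [Complex.norm_exp_ofReal_mul_I])
  have hlt : ∀ᵐ p ∂(cellMeasure d).prod (Measure.count : Measure (Fin Γ.cellCard)),
      ENNReal.ofReal (∑ v, ‖(P.proj p.2 p.1 *ᵥ fun w => Γ.floquet ψ w p.1) v‖ ^ 2) < ⊤ :=
    Eventually.of_forall fun p => ENNReal.ofReal_lt_top
  rw [bandMeasure, integrable_withDensity_iff_integrable_smul' (P.measurable_density ψ) hlt] at hi
  rw [charFun_apply, limitLaw, integral_map Q.measurable_velocity.aemeasurable
    (by fun_prop), bandMeasure,
    integral_withDensity_eq_integral_toReal_smul (P.measurable_density ψ) hlt, integral_prod _ hi]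
  refine integral_congr_ae ?_
  -- Differentiability is what turns the partial derivatives in `velocity` into the derivative in
  -- the direction of the dual coordinates of `ξ`.
  filter_upwards [ae_restrict_of_ae Q.ae_differentiableAt_bandFunction] with θ hθ
  rw [integral_fintype (.of_finite)]
  refine Finset.sum_congr rfl fun n _ => ?_
  rw [Q.fderiv_bandFunction_dualCoord (hθ n), density_eq, ENNReal.toReal_ofReal (sq_nonneg _),
    mul_comm Complex.I, mul_comm (Complex.exp _)]
  simp

end Eigenprojections

lemma tsum_ofReal_norm_sq (f : Γ.L2) :
    ∑' v, ENNReal.ofReal (‖f v‖ ^ 2) = ENNReal.ofReal (‖f‖ ^ 2) := by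
  have hf : Summable fun v => ‖f v‖ ^ 2 := (Γ.memLp_two_iff f).1 (lp.memℓp f)
  rw [← ENNReal.ofReal_tsum_of_nonneg (fun v => sq_nonneg _) hf]
  congr 1
  have := lp.norm_rpow_eq_tsum (p := 2) (by simp) f
  simpa using this.symm

theorem isProbabilityMeasure_positionLaw {ψ : Γ.L2} (hψ : ‖ψ‖ = 1) (t : ℝ) :
    IsProbabilityMeasure (Q.positionLaw ψ t) := by
  constructor
  rw [positionLaw, Measure.sum_apply _ MeasurableSet.univ]
  simp only [Measure.smul_apply, measure_univ, smul_eq_mul, mul_one]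
  rw [tsum_ofReal_norm_sq, norm_evolution, hψ]
  simp

/-- For a sum of point masses the characteristic function is `∑ e^{iξ·v} |e^{-itH}ψ(v)|²`, a
quadratic form of the modulation operator. -/
lemma charFun_positionLaw {ψ : Γ.L2} (hψ : ‖ψ‖ = 1) (t : ℝ) (ξ : EuclideanSpace ℝ (Fin d)) :
    charFun (Q.positionLaw ψ t) ξ =
      inner ℂ (Q.evolution t ψ) (Γ.modulate ξ (Q.evolution t ψ)) := by
  have := isProbabilityMeasure_positionLaw (Q := Q) hψ t
  have hm : Measurable fun x : EuclideanSpace ℝ (Fin d) =>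
      Complex.exp ((inner ℝ x ξ : ℝ) * Complex.I) := by fun_prop
  have hi : Integrable (fun x => Complex.exp ((inner ℝ x ξ : ℝ) * Complex.I))
      (Q.positionLaw ψ t) :=
    Integrable.of_bound hm.aestronglyMeasurable 1 (Eventually.of_forall fun p => by
      rw [Complex.norm_exp_ofReal_mul_I])
  rw [positionLaw] at hi
  rw [charFun_apply, positionLaw, ← (hasSum_integral_measure hi).tsum_eq, lp.inner_eq_tsum]
  refine tsum_congr fun v => ?_
  rw [integral_smul_measure, integral_dirac, ENNReal.toReal_ofReal (sq_nonneg _), modulate_apply,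
    real_inner_comm, RCLike.inner_apply, mul_assoc, Complex.mul_conj, Complex.normSq_eq_norm_sq,
    mul_comm (Complex.exp _), mul_comm Complex.I]
  simp

end PeriodicPotential
end PeriodicGraph

/-! ### Conclusion by Lévy's continuity theorem -/

/-- Ballistic limit law: if `X_t` has distribution `|e^{-itH} ψ(v)|²`, then `X_t / t` converges in
distribution, as `t → +∞`, to a random vector with distribution `ν_∞^ψ = h_* μ^ψ`. -/
theorem mainTheorem5 {d : ℕ} (Γ : PeriodicGraph d) (Q : Γ.PeriodicPotential) (ψ : Γ.L2)
    (hψ : ‖ψ‖ = 1) :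
    (∀ t : ℝ, IsProbabilityMeasure (Q.positionLaw ψ t)) ∧
    Nonempty Q.Eigenprojections ∧
    ∀ P : Q.Eigenprojections,
      IsProbabilityMeasure (P.bandMeasure ψ) ∧
      IsProbabilityMeasure (P.limitLaw ψ) ∧
      ∀ (Ω : ℝ → Type*) [∀ t, MeasurableSpace (Ω t)]
        (μ : ∀ t, Measure (Ω t)) [∀ t, IsProbabilityMeasure (μ t)]
        (X : ∀ t, Ω t → EuclideanSpace ℝ (Fin d))
        (Ω' : Type*) [MeasurableSpace Ω'] (ρ : Measure Ω') [IsProbabilityMeasure ρ]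
        (Y : Ω' → EuclideanSpace ℝ (Fin d)),
        (∀ t, HasLaw (X t) (Q.positionLaw ψ t) (μ t)) →
        HasLaw Y (P.limitLaw ψ) ρ →
        TendstoInDistribution (fun t ω => t⁻¹ • X t ω) atTop Y μ ρ := by
  refine ⟨PeriodicGraph.PeriodicPotential.isProbabilityMeasure_positionLaw hψ,
    Q.nonempty_eigenprojections, fun P => ⟨P.isProbabilityMeasure_bandMeasure hψ,
      P.isProbabilityMeasure_limitLaw hψ, ?_⟩⟩
  intro Ω _ μ _ X Ω' _ ρ _ Y hX hY
  refine ⟨fun t => (hX t).aemeasurable.fun_const_smul _, hY.aemeasurable, ?_⟩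
  -- The continuity theorem is applied along an arbitrary sequence of times tending to infinity.
  refine tendsto_of_seq_tendsto fun s hs => ?_
  refine ProbabilityMeasure.tendsto_of_tendsto_charFun fun ξ => ?_
  -- With this direction the modulation at time `t` is by `ξ/t`, and the characteristic function of
  -- `X_t/t` at `ξ` is that of `X_t` at `ξ/t`.
  have hlim := P.tendsto_inner_modulate_evolution ψ (Γ.dualCoord ξ)
  rw [← P.charFun_limitLaw hψ] at hlim
  simp only [Γ.dualVec_smul, Γ.dualVec_dualCoord] at hlim
  change Tendsto (fun n => charFun ((μ (s n)).map fun ω => (s n)⁻¹ • X (s n) ω) ξ) atTop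
    (nhds (charFun (ρ.map Y) ξ))
  rw [hY.map_eq]
  refine (hlim.comp hs).congr fun n => ?_
  simp only [Function.comp_apply]
  rw [charFun_map_smul_comp (hX _).aemeasurable, (hX _).map_eq,
    PeriodicGraph.PeriodicPotential.charFun_positionLaw hψ]
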